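/- **Model.** Let $\gamma_1,\gamma_2,\dots$ be i.i.d. random variables with values in $[0,\infty)$ (fading power gains, one per slot; $F_\gamma(x)=\Pr[\gamma\le x]$), let $M,F\ge 1$ be finite integers, $\overline P>0$, and $\star\in\{\mathrm{ALO},\mathrm{RTD},\mathrm{INR}\}$. Data packets of rate $R$ are sent one after the other, each in at most $M$ consecutive slots. If the attempts $t=1,\dots,m$ for a packet see gains $\gamma_t$ and use powers $Q_t$, the packet is decoded after attempt $m$ iff $\max_{t\le m}\log(1+\gamma_tQ_t)\ge R$ (ALO), $\log(1+\sum_{t\le m}\gamma_tQ_t)\ge R$ (RTD), $\sum_{t\le m}\log(1+\gamma_tQ_t)\ge R$ (INR). An admissible scheme consists of a rate $R\ge0$, feedback values $B_m\in\{0,\dots,F-1\}$ that are measurable functions of the gains $(\gamma_1,\dots,\gamma_m)$ seen by the current packet, powers $P_{m,f}\in[0,\infty)$ used at attempt $m$ when $B_m=f$, and a rule that decides from $(m,B_m)$ whether the transmission of the packet ends with attempt $m$; it always ends with attempt $M$, and ends earlier only if the packet is decoded. Let $\mathcal T$ be the number of attempts for a packet, $\mathcal R$ its reward ($R$ if it is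 decoded when its transmission ends, else $0$) and $\mathcal P$ the sum of the powers used for it. The throughput and the average power of a scheme are the almost sure limits of $\frac1T\sum_{t\le T}R\,1_{\{\text{a packet ends, decoded, in slot }t\}}$ and $\frac1T\sum_{t\le T}Q_t$. Let $\eta^{(\star)}_{M,F}$ be the supremum of the throughput over the admissible schemes of average power at most $\overline P$; its renewal-reward form is the supremum of $\mathbb E[\mathcal R]/\mathbb E[\mathcal T]$ subject to $\mathbb E[\mathcal P]/\mathbb E[\mathcal T]\le\overline P$. **Proposed scheme.** Let $R>0$ and let $\tau_m\in(0,\infty]$ and $0=s_{m,0}<s_{m,1}\le\dots\le s_{m,F-1}\le s_{m,F}=\infty$ for $m=1,\dots,M$ (with $1/\infty=0$). Put $\xi^{(\star)}_1=1$ and, for $m>1$, $$\xi_m^{\rm(ALO)}=\prod_{t<m}1_{\{1-\gamma_t/\tau_t>0\}},\quad \xi_m^{\rm(RTD)}=1-\sum_{t<m}\frac{\gamma_t}{\tau_t},\quad \xi_m^{\rm(INR)}=\Big(\frac{e^R}{\prod_{t<m}(1+(e^R-1)\gamma_t/\tau_t)}-1\Big)\frac1{e^R-1}.$$ The receiver sends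 $B_m=f$ if $\xi_m>0$ and $\gamma_m/\xi_m\in[s_{m,f},s_{m,f+1})$, and $B_m=F-1$ if $\xi_m\le0$. The power is $P_m=\frac{e^R-1}{\tau_m}1_{\{B_m=0\}}+\sum_{f=1}^{F-1}\frac{e^R-1}{s_{m,f}}1_{\{B_m=f\}}$. After attempt $m<M$ the packet is retransmitted iff $B_m=0$. **Probabilities.** For $a\in[0,\infty]$ let $\widetilde p_m(a)$ be the probability of the following event, where in each case the first condition is for all $t<m$: ALO: $\frac{\gamma_t}{\min\{\tau_t,s_{t,1}\}}<1$, and $\gamma_m<a$; RTD: $\sum_{\ell<t}\frac{\gamma_\ell}{\tau_\ell}+\frac{\gamma_t}{\min\{\tau_t,s_{t,1}\}}<1$, and $\gamma_m/\xi_m^{\rm(RTD)}<a$; INR: $\prod_{\ell<t}\big(1+(e^R-1)\frac{\gamma_\ell}{\tau_\ell}\big)\cdot\big(1+(e^R-1)\frac{\gamma_t}{\min\{\tau_t,s_{t,1}\}}\big)\,e^{-R}<1$, and $\gamma_m/\xi_m^{\rm(INR)}<a$. For $1\le m\le M$ let $p_{m,f}=\widetilde p_m(s_{m,f+1})$ for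 $0\le f\le F-2$ and $p_{m,F-1}=p_{m-1,0}$ (with $p_{0,0}=1$), and let $\mathsf P_{\rm out}=\widetilde p_{M+1}(\infty)$. Put $$E=1+\sum_{m=1}^{M-1}p_{m,0},\qquad D=\sum_{m=1}^{M}\Big(\sum_{f=1}^{F-1}\frac{p_{m,f}-p_{m,f-1}}{s_{m,f}}+\frac{p_{m,0}}{\tau_m}\Big),\qquad \eta=\frac{1-\mathsf P_{\rm out}}{E}\,\log\Big(1+\overline P\,\frac ED\Big),$$ where the logarithm is read as $0$ if $D=0$ (then $\mathsf P_{\rm out}=1$). **Theorem.** 1. For all such $R$, $\tau$, $s$ the proposed scheme is admissible; $p_{m,f}=\Pr[B_1=\dots=B_{m-1}=0,\,B_m\le f]$ for all $1\le m\le M$, $0\le f\le F-1$; $\mathsf P_{\rm out}=\Pr[B_1=\dots=B_M=0,\text{ not decoded after attempt }M]$; $\mathbb E[\mathcal T]=E$, $\mathbb E[\mathcal R]=R(1-\mathsf P_{\rm out})$, $\mathbb E[\mathcal P]=(e^R-1)D$. 2. Its average power is $\overline P$ if and only if $R=\log(1+\overline P E/D)$. In that case $\mathbb E[\mathcal P]/\mathbb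 E[\mathcal T]=\overline P$ and its throughput, which equals $\mathbb E[\mathcal R]/\mathbb E[\mathcal T]$, is $\eta$. 3. For ALO, $\widetilde p_m(a)=\big(\prod_{t<m}\Pr[\gamma<\min\{\tau_t,s_{t,1}\}]\big)\Pr[\gamma<a]$ for $1\le m\le M+1$, which is $\big(\prod_{t<m}F_\gamma(\min\{\tau_t,s_{t,1}\})\big)F_\gamma(a)$ if the law of $\gamma$ has no atoms. 4. Let $\eta^{(\star)}_{M,F,\rm lb}$ be the supremum of $\eta$ over all $R>0$ and all $\tau,s$ as above with $R=\log(1+\overline PE/D)$. For ALO and RTD, where $\eta$ does not depend on $R$, it is the supremum of $\eta$ over all $\tau,s$ as above, without any condition on $R$. For all three protocols, $\eta^{(\star)}_{M,F,\rm lb}\le\eta^{(\star)}_{M,F}$, for $\eta^{(\star)}_{M,F}$ as defined above and also for its renewal-reward form. -/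

import Mathlib

open MeasureTheory ProbabilityTheory Filter Topology
open scoped NNReal ENNReal

namespace HARQ

/-- The three retransmission protocols. -/
inductive Protocol
  | ALO
  | RTD
  | INR

/-- `decoded proto R snr n`: the data packet of rate `R` has been decoded by the end of its `n`-th
transmission, when the `t`-th transmission (counted from `0`) arrives with received
signal-to-noise ratio `snr t` (fading power gain times transmit power). For ALO only single
transmissions are used for decoding, RTD adds up signal-to-noise ratios and INR adds up mutual
informations. -/
def decoded : Protocol → ℝ → (ℕ → ℝ) → ℕ → Prop
  | .ALO, R, snr, n => ∃ t < n, R ≤ Real.log (1 + snr t)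
  | .RTD, R, snr, n => R ≤ Real.log (1 + ∑ t ∈ Finset.range n, snr t)
  | .INR, R, snr, n => R ≤ ∑ t ∈ Finset.range n, Real.log (1 + snr t)

/-! ### General feedback / power schemes

Transmission attempts of a packet, slots and feedback values are all counted from `0`; the gains
seen by one packet are a sequence `g`, with `g m` the gain during attempt `m`. -/

/-- A feedback and power scheme that starts anew with each data packet: the rate `R`, the feedback
value sent at attempt `m` when the packet sees the gains `g`, the power `P_{m,f}` used at attempt
`m` upon feedback `f`, and whether the transmitter, having received feedback `f` at attempt `m`,
moves on to a new packet after that attempt (it always does after the `M`-th attempt). -/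
structure Scheme where
  rate : ℝ
  feedback : ℕ → (ℕ → ℝ≥0) → ℕ
  power : ℕ → ℕ → ℝ
  final : ℕ → ℕ → Prop

namespace Scheme

/-- Transmit power at attempt `m`. -/
def txPower (σ : Scheme) (g : ℕ → ℝ≥0) (m : ℕ) : ℝ := σ.power m (σ.feedback m g)

/-- Received signal-to-noise ratio at attempt `m`. -/
def snr (σ : Scheme) (g : ℕ → ℝ≥0) (m : ℕ) : ℝ := (g m : ℝ) * σ.txPower g m

/-- The transmission of the packet ends with attempt `m` (if that attempt takes place). -/
def endsAt (σ : Scheme) (M : ℕ) (g : ℕ → ℝ≥0) (m : ℕ) : Prop :=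
  σ.final m (σ.feedback m g) ∨ M ≤ m + 1

/-- The number of slots spent on a packet (inter-renewal time). -/
noncomputable def duration (σ : Scheme) (M : ℕ) (g : ℕ → ℝ≥0) : ℕ :=
  sInf {m | σ.endsAt M g m} + 1

open Classical in
/-- The reward of a packet: `R` if it is decoded when its transmission ends, else `0`. -/
noncomputable def reward (σ : Scheme) (proto : Protocol) (M : ℕ) (g : ℕ → ℝ≥0) : ℝ :=
  if decoded proto σ.rate (σ.snr g) (σ.duration M g) then σ.rate else 0

/-- The total transmit power spent on a packet. -/
noncomputable def cost (σ : Scheme) (M : ℕ) (g : ℕ → ℝ≥0) : ℝ :=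
  ∑ m ∈ Finset.range (σ.duration M g), σ.txPower g m

/-- Admissible schemes with at most `M` attempts per packet and `F` feedback values: feedback is
measurable and causal, powers are nonnegative, and the transmission of a packet ends before the
`M`-th attempt only if the packet has been decoded. -/
structure Admissible (σ : Scheme) (proto : Protocol) (M F : ℕ) : Prop where
  rate_nonneg : 0 ≤ σ.rate
  feedback_lt : ∀ m g, σ.feedback m g < F
  feedback_measurable : ∀ m, Measurable (σ.feedback m)
  feedback_causal : ∀ m g g', (∀ i ≤ m, g i = g' i) → σ.feedback m g = σ.feedback m g'
  power_nonneg : ∀ m f, 0 ≤ σ.power m f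
  decoded_of_early_end :
    ∀ g, σ.duration M g < M → decoded proto σ.rate (σ.snr g) (σ.duration M g)

/-! ### Operation over the slots -/

open Classical in
/-- `age σ M x t` is the number of attempts already made, before slot `t`, for the packet
transmitted in slot `t`, when the gain in slot `i` is `x i`. That packet was first sent in slot
`t - age σ M x t`. -/
noncomputable def age (σ : Scheme) (M : ℕ) (x : ℕ → ℝ≥0) : ℕ → ℕ
  | 0 => 0
  | t + 1 =>
    if σ.endsAt M (fun i => x (t - age σ M x t + i)) (age σ M x t) then 0
    else age σ M x t + 1

/-- The gains seen by the packet transmitted in slot `t`, from its first attempt on. -/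
noncomputable def packetGains (σ : Scheme) (M : ℕ) (x : ℕ → ℝ≥0) (t : ℕ) : ℕ → ℝ≥0 :=
  fun i => x (t - σ.age M x t + i)

/-- Transmit power in slot `t`. -/
noncomputable def slotPower (σ : Scheme) (M : ℕ) (x : ℕ → ℝ≥0) (t : ℕ) : ℝ :=
  σ.txPower (σ.packetGains M x t) (σ.age M x t)

open Classical in
/-- Reward in slot `t`: `R` if the transmission of a packet ends in slot `t` with the packet
decoded. Every decoded packet is counted exactly once. -/
noncomputable def slotReward (σ : Scheme) (proto : Protocol) (M : ℕ) (x : ℕ → ℝ≥0) (t : ℕ) : ℝ :=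
  if σ.endsAt M (σ.packetGains M x t) (σ.age M x t) ∧
      decoded proto σ.rate (σ.snr (σ.packetGains M x t)) (σ.age M x t + 1)
  then σ.rate else 0

variable {Ω : Type*} [MeasurableSpace Ω]

/-- The long-term average number of decoded nats per channel use is almost surely `η`. -/
def HasThroughput (σ : Scheme) (μ : Measure Ω) (γ : ℕ → Ω → ℝ≥0) (proto : Protocol) (M : ℕ)
    (η : ℝ) : Prop :=
  ∀ᵐ ω ∂μ, Tendsto
    (fun T : ℕ => (∑ t ∈ Finset.range T, σ.slotReward proto M (fun i => γ i ω) t) / (T : ℝ))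
    atTop (𝓝 η)

/-- The long-term average transmit power is almost surely `p`. -/
def HasAveragePower (σ : Scheme) (μ : Measure Ω) (γ : ℕ → Ω → ℝ≥0) (M : ℕ) (p : ℝ) : Prop :=
  ∀ᵐ ω ∂μ, Tendsto
    (fun T : ℕ => (∑ t ∈ Finset.range T, σ.slotPower M (fun i => γ i ω) t) / (T : ℝ))
    atTop (𝓝 p)

/-- Mean inter-renewal time. -/
noncomputable def meanTime (σ : Scheme) (μ : Measure Ω) (γ : ℕ → Ω → ℝ≥0) (M : ℕ) : ℝ :=
  ∫ ω, (σ.duration M (fun i => γ i ω) : ℝ) ∂μ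

/-- Mean reward of a packet. -/
noncomputable def meanReward (σ : Scheme) (μ : Measure Ω) (γ : ℕ → Ω → ℝ≥0) (proto : Protocol)
    (M : ℕ) : ℝ :=
  ∫ ω, σ.reward proto M (fun i => γ i ω) ∂μ

/-- Mean cost of a packet. -/
noncomputable def meanCost (σ : Scheme) (μ : Measure Ω) (γ : ℕ → Ω → ℝ≥0) (M : ℕ) : ℝ :=
  ∫ ω, σ.cost M (fun i => γ i ω) ∂μ

end Scheme

section Optimum

variable {Ω : Type*} [MeasurableSpace Ω]

/-- The optimal throughput, operationally: the supremum of the almost sure long-term throughputs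
of all admissible schemes whose almost sure long-term average power is at most `Pbar`. -/
noncomputable def optThroughput (μ : Measure Ω) (γ : ℕ → Ω → ℝ≥0) (proto : Protocol) (M F : ℕ)
    (Pbar : ℝ) : ℝ≥0∞ :=
  sSup {y | ∃ (σ : Scheme) (η p : ℝ), σ.Admissible proto M F ∧ σ.HasThroughput μ γ proto M η ∧
    σ.HasAveragePower μ γ M p ∧ p ≤ Pbar ∧ y = ENNReal.ofReal η}

/-- The optimal throughput in renewal-reward form: the supremum of (mean reward) / (mean
inter-renewal time) subject to (mean cost) / (mean inter-renewal time) being at most `Pbar`. -/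
noncomputable def optRenewalThroughput (μ : Measure Ω) (γ : ℕ → Ω → ℝ≥0) (proto : Protocol)
    (M F : ℕ) (Pbar : ℝ) : ℝ≥0∞ :=
  sSup {y | ∃ σ : Scheme, σ.Admissible proto M F ∧
    σ.meanCost μ γ M / σ.meanTime μ γ M ≤ Pbar ∧
    y = ENNReal.ofReal (σ.meanReward μ γ proto M / σ.meanTime μ γ M)}

end Optimum

/-! ### The proposed protocol -/

/-- The thresholds `τ_m` and `s_{m,f}`, with values in `[0, ∞]`. -/
structure Thresholds where
  τ : ℕ → ℝ≥0∞
  s : ℕ → ℕ → ℝ≥0∞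

/-- `0 < τ_m` and `0 = s_{m,0} < s_{m,1} ≤ ⋯ ≤ s_{m,F-1} ≤ s_{m,F} = ∞` at each of the `M` attempts.
The thresholds that occur as denominators are positive, since transmit powers are finite. -/
def Thresholds.Valid (θ : Thresholds) (M F : ℕ) : Prop :=
  ∀ m < M, 0 < θ.τ m ∧ θ.s m 0 = 0 ∧ 0 < θ.s m 1 ∧ θ.s m F = ⊤ ∧
    ∀ f < F, θ.s m f ≤ θ.s m (f + 1)

/-- `x / a` for `x` finite and `a` in `(0, ∞]`. -/
noncomputable def quot (x : ℝ≥0) (a : ℝ≥0∞) : ℝ := ((x : ℝ≥0∞) / a).toReal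

open Classical in
/-- The scaling `ξ_m` of the gain at attempt `m`; it depends on `g 0, …, g (m - 1)` and equals `1` at
the first attempt `m = 0` (if `R ≠ 0`). -/
noncomputable def scaling (proto : Protocol) (R : ℝ) (θ : Thresholds) (g : ℕ → ℝ≥0) (m : ℕ) : ℝ :=
  match proto with
  | .ALO => ∏ t ∈ Finset.range m, if 0 < 1 - quot (g t) (θ.τ t) then 1 else 0
  | .RTD => 1 - ∑ t ∈ Finset.range m, quot (g t) (θ.τ t)
  | .INR =>
    (Real.exp R / ∏ t ∈ Finset.range m, (1 + (Real.exp R - 1) * quot (g t) (θ.τ t)) - 1) *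
      (1 / (Real.exp R - 1))

open Classical in
/-- The feedback `B_m`: the index `f` with `g m / ξ_m ∈ [s_{m,f}, s_{m,f+1})` if `ξ_m > 0`, and `F - 1`
if `ξ_m ≤ 0`. -/
noncomputable def quantFeedback (proto : Protocol) (F : ℕ) (R : ℝ) (θ : Thresholds)
    (m : ℕ) (g : ℕ → ℝ≥0) : ℕ :=
  if 0 < scaling proto R θ g m then
    Nat.findGreatest
      (fun f => θ.s m f ≤ ENNReal.ofReal ((g m : ℝ) / scaling proto R θ g m)) (F - 1)
  else F - 1

/-- For valid thresholds and `ξ_m > 0`, `B_m` is the index of the quantization cell. -/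
theorem quantFeedback_eq_iff {proto : Protocol} {M F : ℕ} {R : ℝ} {θ : Thresholds}
    (hθ : θ.Valid M F) {m : ℕ} (hm : m < M) {g : ℕ → ℝ≥0}
    (hξ : 0 < scaling proto R θ g m) {f : ℕ} (hf : f < F) :
    quantFeedback proto F R θ m g = f ↔
      ENNReal.ofReal ((g m : ℝ) / scaling proto R θ g m) ∈ Set.Ico (θ.s m f) (θ.s m (f + 1)) := by
  classical
  obtain ⟨-, h0, -, htop, hmono⟩ := hθ m hm
  have hmono' : ∀ a b, a ≤ b → b ≤ F → θ.s m a ≤ θ.s m b := by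
    intro a b hab
    induction b, hab using Nat.le_induction with
    | base => intro _; exact le_rfl
    | succ b _ ih => intro hb; exact (ih (by omega)).trans (hmono b (by omega))
  unfold quantFeedback
  rw [if_pos hξ, Nat.findGreatest_eq_iff]
  constructor
  · rintro ⟨_, h2, h3⟩
    refine ⟨?_, ?_⟩
    · by_cases hf0 : f = 0
      · subst hf0; simp [h0]
      · exact h2 hf0
    · by_cases hfF : f + 1 = F
      · rw [hfF, htop]; exact ENNReal.ofReal_lt_top
      · exact not_le.mp (h3 (Nat.lt_succ_self f) (by omega))
  · rintro ⟨h1, h2⟩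
    refine ⟨by omega, fun _ => h1, fun n hn hnF => ?_⟩
    exact not_le.mpr (h2.trans_le (hmono' _ _ hn (by omega)))

/-- The proposed scheme: feedback `B_m`, power `(e^R - 1) / τ_m` upon `B_m = 0` and
`(e^R - 1) / s_{m,f}` upon `B_m = f > 0`; before the last attempt the transmitter moves on to a new
packet exactly if the feedback is not `0`. -/
noncomputable def proposed (proto : Protocol) (F : ℕ) (R : ℝ) (θ : Thresholds) : Scheme where
  rate := R
  feedback := quantFeedback proto F R θ
  power m f := (Real.exp R - 1) * ((if f = 0 then θ.τ m else θ.s m f)⁻¹).toReal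
  final _ f := f ≠ 0

/-! ### The throughput formula -/

section Formula

variable {Ω : Type*} [MeasurableSpace Ω]

/-- The event whose probability is `p̃_{m,f}`, with `a` in the place of `s_{m,f+1}`. -/
def ptildeEvent (proto : Protocol) (R : ℝ) (θ : Thresholds) (g : ℕ → ℝ≥0) (m : ℕ) (a : ℝ≥0∞) :
    Prop :=
  match proto with
  | .ALO =>
    (∀ t < m, quot (g t) (min (θ.τ t) (θ.s t 1)) < 1) ∧ (g m : ℝ≥0∞) < a
  | .RTD =>
    (∀ t < m, ∑ l ∈ Finset.range t, quot (g l) (θ.τ l) + quot (g t) (min (θ.τ t) (θ.s t 1)) < 1) ∧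
      ENNReal.ofReal ((g m : ℝ) / (1 - ∑ l ∈ Finset.range m, quot (g l) (θ.τ l))) < a
  | .INR =>
    (∀ t < m, (∏ l ∈ Finset.range t, (1 + (Real.exp R - 1) * quot (g l) (θ.τ l))) *
        (1 + (Real.exp R - 1) * quot (g t) (min (θ.τ t) (θ.s t 1))) / (1 + (Real.exp R - 1)) < 1) ∧
      ENNReal.ofReal ((g m : ℝ) / scaling .INR R θ g m) < a

/-- The probability `p̃_{m,f}`, with `a` in the place of `s_{m,f+1}`. -/
noncomputable def ptilde (μ : Measure Ω) (γ : ℕ → Ω → ℝ≥0) (proto : Protocol) (R : ℝ)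
    (θ : Thresholds) (m : ℕ) (a : ℝ≥0∞) : ℝ :=
  μ.real {ω | ptildeEvent proto R θ (fun i => γ i ω) m a}

/-- The probabilities `p_{m,f}`, `f < F`: they are `p̃_{m,f}` for `f ≤ F - 2`, while
`p_{m,F-1} = p_{m-1,0}` (and `1` at the first attempt). -/
noncomputable def pProb (μ : Measure Ω) (γ : ℕ → Ω → ℝ≥0) (proto : Protocol) (F : ℕ) (R : ℝ)
    (θ : Thresholds) : ℕ → ℕ → ℝ
  | 0, f => if f + 1 < F then ptilde μ γ proto R θ 0 (θ.s 0 (f + 1)) else 1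
  | m + 1, f =>
    if f + 1 < F then ptilde μ γ proto R θ (m + 1) (θ.s (m + 1) (f + 1))
    else pProb μ γ proto F R θ m 0

/-- The outage probability: `p̃` at a fictitious further attempt with threshold `∞`. -/
noncomputable def pOut (μ : Measure Ω) (γ : ℕ → Ω → ℝ≥0) (proto : Protocol) (M : ℕ) (R : ℝ)
    (θ : Thresholds) : ℝ :=
  ptilde μ γ proto R θ M ⊤

/-- `1 + ∑ p_{m,0}` over all attempts but the last. -/
noncomputable def timeSum (μ : Measure Ω) (γ : ℕ → Ω → ℝ≥0) (proto : Protocol) (M F : ℕ) (R : ℝ)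
    (θ : Thresholds) : ℝ :=
  1 + ∑ m ∈ Finset.range (M - 1), pProb μ γ proto F R θ m 0

/-- `∑_m (∑_{f=1}^{F-1} (p_{m,f} - p_{m,f-1}) / s_{m,f} + p_{m,0} / τ_m)`. -/
noncomputable def powerSum (μ : Measure Ω) (γ : ℕ → Ω → ℝ≥0) (proto : Protocol) (M F : ℕ) (R : ℝ)
    (θ : Thresholds) : ℝ :=
  ∑ m ∈ Finset.range M,
    (∑ f ∈ Finset.Ico 1 F,
        (pProb μ γ proto F R θ m f - pProb μ γ proto F R θ m (f - 1)) * ((θ.s m f)⁻¹).toReal +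
      pProb μ γ proto F R θ m 0 * ((θ.τ m)⁻¹).toReal)

/-- `log (1 + Pbar (1 + ∑ p_{m,0}) / powerSum)`. -/
noncomputable def rateFormula (μ : Measure Ω) (γ : ℕ → Ω → ℝ≥0) (proto : Protocol) (M F : ℕ)
    (Pbar R : ℝ) (θ : Thresholds) : ℝ :=
  Real.log (1 + Pbar * (timeSum μ γ proto M F R θ / powerSum μ γ proto M F R θ))

/-- The throughput formula, for given thresholds. -/
noncomputable def throughputFormula (μ : Measure Ω) (γ : ℕ → Ω → ℝ≥0) (proto : Protocol)
    (M F : ℕ) (Pbar R : ℝ) (θ : Thresholds) : ℝ :=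
  (1 - pOut μ γ proto M R θ) / timeSum μ γ proto M F R θ * rateFormula μ γ proto M F Pbar R θ

/-- The lower bound `η_{M,F,lb}`: the supremum of the throughput formula over all valid thresholds,
where the rate `R` (on which the INR probabilities depend) is the one given by the power budget. -/
noncomputable def etaLB (μ : Measure Ω) (γ : ℕ → Ω → ℝ≥0) (proto : Protocol) (M F : ℕ)
    (Pbar : ℝ) : ℝ≥0∞ :=
  sSup {y | ∃ (R : ℝ) (θ : Thresholds), 0 < R ∧ θ.Valid M F ∧
    R = rateFormula μ γ proto M F Pbar R θ ∧
    y = ENNReal.ofReal (throughputFormula μ γ proto M F Pbar R θ)}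

end Formula

end HARQ

/-! Two independent arguments are combined: a renewal-reward theorem for arbitrary admissible
schemes, and an exact analysis of one packet under the proposed scheme.

Renewal part. Causality makes the duration of a packet a stopping time, so the map `nextGains`,
which deletes the slots of the first packet, preserves the product law, and its output is
independent of everything decided by the first packet (`measure_inter_nextGains`). Iterating it
gives identically distributed, pairwise independent packet payoffs, and the strong law applies to
payoffs and durations. A deterministic sandwich between consecutive renewal times
(`tendsto_div_of_renewal`) turns averages over packets into averages over slots. Throughput and
average power are therefore almost surely the ratios of means.

One packet. While the feedback is `0`, `ξ_m` is the received SNR still missing, in units of `e^R -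
1`: an attempt with power `(e^R - 1) / a` leaves the packet undecoded iff `γ_m / a < ξ_m`
(`scaling_succ_pos_iff`, `decoded_iff_scaling`). Feedback `f > 0` certifies `γ_m / s_{m,f} ≥ ξ_m` or
`ξ_m ≤ 0`, hence decoding, so only an unbroken run of zeros can end in outage. Comparing with `min
τ_t s_{t,1}` demands feedback `0` and failure at once, which identifies the events behind `ptilde`
(`forall_continues_iff`). The means are then finite sums of these probabilities, and `(e^R - 1) D /
E = Pbar` is solved for `R`. The lower bounds follow because each proposed scheme that meets the
budget competes in both suprema. -/

namespace HARQ

/-! ### Shifts of independent, identically distributed gains -/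

/-- The sequence of gains from slot `n` on. -/
def shift (n : ℕ) (x : ℕ → ℝ≥0) : ℕ → ℝ≥0 := fun i => x (n + i)

theorem measurable_shift (n : ℕ) : Measurable (shift n) := by
  unfold shift; fun_prop

theorem measurePreserving_shift (P : Measure ℝ≥0) [IsProbabilityMeasure P] (n : ℕ) :
    MeasurePreserving (shift n) (Measure.infinitePi fun _ : ℕ => P)
      (Measure.infinitePi fun _ : ℕ => P) :=
  ⟨measurable_shift n, Measure.map_infinitePi_infinitePi_of_inj (P := fun _ : ℕ => P)
    (add_right_injective n)⟩

/-- A function of the first `n` gains is independent of the later gains. -/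
theorem indepFun_shift (P : Measure ℝ≥0) [IsProbabilityMeasure P] {n : ℕ} {β : Type*}
    [MeasurableSpace β] {f : (ℕ → ℝ≥0) → β} (hf : Measurable f)
    (hn : ∀ x y : ℕ → ℝ≥0, (∀ i < n, x i = y i) → f x = f y) :
    IndepFun f (shift n) (Measure.infinitePi fun _ : ℕ => P) := by
  have h1 : iIndepFun (fun (i : ℕ) (x : ℕ → ℝ≥0) => x i) (Measure.infinitePi fun _ : ℕ => P) :=
    iIndepFun_infinitePi (X := fun _ x => x) (fun _ => measurable_id)
  have h2 := indep_iSup_of_disjoint (fun i => (measurable_pi_apply i).comap_le) h1.iIndep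
    (S := Set.Iio n) (T := Set.Ici n) (Set.Iio_disjoint_Ici le_rfl)
  refine indep_of_indep_of_le_left (indep_of_indep_of_le_right h2 ?_) ?_
  · refine Measurable.comap_le ?_
    refine @measurable_pi_lambda _ _ _ (_) _ _ fun i => ?_
    have : Measurable[MeasurableSpace.comap (fun x : ℕ → ℝ≥0 => x (n + i)) inferInstance]
      (fun x : ℕ → ℝ≥0 => x (n + i)) := comap_measurable _
    exact this.mono (le_iSup₂_of_le (n + i) (Set.mem_Ici.2 (Nat.le_add_right n i)) le_rfl) le_rfl
  -- Replacing all gains from index `n` on by `0` does not change `f`, and the truncated sequence is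
  -- measurable for the first `n` coordinates.
  · have hfe : f = f ∘ fun x i => if i < n then x i else 0 := by
      funext x
      exact hn _ _ fun i hi => by simp [hi]
    rw [hfe]
    refine Measurable.comap_le ?_
    refine hf.comp ?_
    refine @measurable_pi_lambda _ _ _ (_) _ _ fun i => ?_
    by_cases hi : i < n
    · simp only [hi, if_true]
      have : Measurable[MeasurableSpace.comap (fun x : ℕ → ℝ≥0 => x i) inferInstance]
        (fun x : ℕ → ℝ≥0 => x i) := comap_measurable _
      exact this.mono (le_iSup₂_of_le i (Set.mem_Iio.2 hi) le_rfl) le_rfl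
    · simp only [hi, if_false]
      exact measurable_const

namespace Scheme

variable {σ : Scheme} {M : ℕ}

/-- Feedback is measurable and causal. -/
structure Regular (σ : Scheme) : Prop where
  measurable : ∀ m, Measurable (σ.feedback m)
  causal : ∀ m g g', (∀ i ≤ m, g i = g' i) → σ.feedback m g = σ.feedback m g'

theorem Admissible.regular {proto : Protocol} {F : ℕ} (h : σ.Admissible proto M F) : σ.Regular :=
  ⟨h.feedback_measurable, h.feedback_causal⟩

/-! ### The duration of a packet -/

theorem endsAt_nonempty (σ : Scheme) (M : ℕ) (g : ℕ → ℝ≥0) : {m | σ.endsAt M g m}.Nonempty :=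
  ⟨M, Or.inr (Nat.le_succ M)⟩

theorem duration_pos (σ : Scheme) (M : ℕ) (g : ℕ → ℝ≥0) : 0 < σ.duration M g := Nat.succ_pos _

theorem endsAt_duration (σ : Scheme) (M : ℕ) (g : ℕ → ℝ≥0) :
    σ.endsAt M g (σ.duration M g - 1) :=
  Nat.sInf_mem (endsAt_nonempty σ M g)

theorem not_endsAt {g : ℕ → ℝ≥0} {m : ℕ} (h : m + 1 < σ.duration M g) : ¬ σ.endsAt M g m :=
  Nat.notMem_of_lt_sInf (s := {m | σ.endsAt M g m}) (by unfold duration at h; omega)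

theorem duration_le (hM : 1 ≤ M) (g : ℕ → ℝ≥0) : σ.duration M g ≤ M := by
  have : sInf {m | σ.endsAt M g m} ≤ M - 1 :=
    Nat.sInf_le (Or.inr (by omega) : σ.endsAt M g (M - 1))
  unfold duration
  omega

theorem duration_eq_iff {g : ℕ → ℝ≥0} {n : ℕ} :
    σ.duration M g = n + 1 ↔ σ.endsAt M g n ∧ ∀ m < n, ¬ σ.endsAt M g m := by
  constructor
  · intro h
    refine ⟨by simpa [h] using endsAt_duration σ M g, fun m hm => not_endsAt (by omega)⟩
  · rintro ⟨h1, h2⟩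
    have h3 : σ.duration M g ≤ n + 1 := by
      have : sInf {m | σ.endsAt M g m} ≤ n := Nat.sInf_le h1
      unfold duration; omega
    by_contra h
    refine h2 (σ.duration M g - 1) ?_ (endsAt_duration σ M g)
    have := duration_pos σ M g
    omega

theorem lt_duration_iff {g : ℕ → ℝ≥0} {n : ℕ} :
    n < σ.duration M g ↔ ∀ m < n, ¬ σ.endsAt M g m := by
  constructor
  · intro h m hm
    exact not_endsAt (by omega)
  · intro h
    by_contra hn
    have := duration_pos σ M g
    exact h (σ.duration M g - 1) (by omega) (endsAt_duration σ M g)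

namespace Regular

variable (hσ : σ.Regular)
include hσ

theorem endsAt_congr {g g' : ℕ → ℝ≥0} {m : ℕ} (h : ∀ i ≤ m, g i = g' i) :
    σ.endsAt M g m ↔ σ.endsAt M g' m := by
  unfold endsAt
  rw [hσ.causal m g g' h]

/-- The stopping-time property: whether a packet ends with a given attempt is decided by the gains
up to that attempt. -/
theorem duration_congr {g g' : ℕ → ℝ≥0} (h : ∀ i < σ.duration M g, g i = g' i) :
    σ.duration M g' = σ.duration M g := by
  obtain ⟨n, hn⟩ : ∃ n, σ.duration M g = n + 1 := ⟨_, rfl⟩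
  rw [hn] at h ⊢
  rw [duration_eq_iff] at hn ⊢
  refine ⟨(hσ.endsAt_congr fun i hi => h i (by omega)).1 hn.1, fun m hm => ?_⟩
  rw [← hσ.endsAt_congr fun i hi => h i (by omega)]
  exact hn.2 m hm

theorem measurableSet_endsAt (m : ℕ) : MeasurableSet {g | σ.endsAt M g m} := by
  have : {g | σ.endsAt M g m} = (σ.feedback m) ⁻¹' {f | σ.final m f ∨ M ≤ m + 1} := rfl
  rw [this]
  exact hσ.measurable m (MeasurableSet.of_discrete)

theorem measurable_duration : Measurable (σ.duration M) := by
  refine measurable_to_countable' fun n => ?_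
  cases n with
  | zero =>
    convert MeasurableSet.empty
    ext g
    simpa using (duration_pos σ M g).ne'
  | succ n =>
    have : σ.duration M ⁻¹' {n + 1} =
        {g | σ.endsAt M g n} ∩ ⋂ m ∈ Set.Iio n, {g | σ.endsAt M g m}ᶜ := by
      ext g
      simp [duration_eq_iff]
    rw [this]
    exact (hσ.measurableSet_endsAt n).inter
      (MeasurableSet.biInter (Set.to_countable _) fun m _ => (hσ.measurableSet_endsAt m).compl)

end Regular

/-! ### Independence of the packets -/

/-- The gains seen by the packets after the first one. -/
noncomputable def nextGains (σ : Scheme) (M : ℕ) (x : ℕ → ℝ≥0) : ℕ → ℝ≥0 :=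
  shift (σ.duration M x) x

namespace Regular

variable (hσ : σ.Regular)
include hσ

theorem measurable_nextGains : Measurable (σ.nextGains M) := by
  refine measurable_pi_iff.2 fun i => ?_
  have h : Measurable (fun p : ℕ × (ℕ → ℝ≥0) => p.2 (p.1 + i)) :=
    measurable_from_prod_countable_right fun n => measurable_pi_apply (n + i)
  exact h.comp (hσ.measurable_duration.prodMk measurable_id)

/-- The strong Markov property at the end of the first packet. Split according to the duration `n`:
there `nextGains` is the deterministic shift by `n`, while `A` together with the duration being `n`
depends on the first `n` gains only. -/
theorem measure_inter_nextGains (P : Measure ℝ≥0) [IsProbabilityMeasure P]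
    {A B : Set (ℕ → ℝ≥0)} (hA : MeasurableSet A) (hB : MeasurableSet B)
    (hd : ∀ x y, (∀ i < σ.duration M x, x i = y i) → x ∈ A → y ∈ A) :
    (Measure.infinitePi fun _ : ℕ => P) (A ∩ σ.nextGains M ⁻¹' B) =
      (Measure.infinitePi fun _ : ℕ => P) A * (Measure.infinitePi fun _ : ℕ => P) B := by
  set ν := Measure.infinitePi fun _ : ℕ => P
  have key : ∀ S : Set (ℕ → ℝ≥0), MeasurableSet S →
      ν S = ∑' n, ν (S ∩ σ.duration M ⁻¹' {n}) := by
    intro S hS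
    rw [← measure_iUnion]
    · congr 1
      ext x
      simp
    · intro a b hab
      refine Set.disjoint_left.2 fun x hx hx' => hab ?_
      exact hx.2.symm.trans hx'.2
    · exact fun n => hS.inter (hσ.measurable_duration (measurableSet_singleton n))
  rw [key _ (hA.inter (hσ.measurable_nextGains hB)), key _ hA, ← ENNReal.tsum_mul_right]
  congr 1
  funext n
  set E := A ∩ σ.duration M ⁻¹' {n}
  have hE : MeasurableSet E := hA.inter (hσ.measurable_duration (measurableSet_singleton n))
  have h1 : A ∩ σ.nextGains M ⁻¹' B ∩ σ.duration M ⁻¹' {n} = E ∩ shift n ⁻¹' B := by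
    ext x
    simp only [E, Set.mem_inter_iff, Set.mem_preimage, Set.mem_singleton_iff, nextGains]
    constructor
    · rintro ⟨⟨h1, h2⟩, h3⟩
      exact ⟨⟨h1, h3⟩, h3 ▸ h2⟩
    · rintro ⟨⟨h1, h3⟩, h2⟩
      exact ⟨⟨h1, by rw [h3]; exact h2⟩, h3⟩
  have hmem : ∀ x y : ℕ → ℝ≥0, (∀ i < n, x i = y i) → x ∈ E → y ∈ E := by
    rintro x y hxy ⟨hx1, hx2⟩
    have hx2 : σ.duration M x = n := hx2
    have hxy' : ∀ i < σ.duration M x, x i = y i := hx2 ▸ hxy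
    exact ⟨hd x y hxy' hx1, (hσ.duration_congr hxy').trans hx2⟩
  have hind : IndepFun (fun x => x ∈ E) (shift n) ν := by
    refine indepFun_shift P (measurableSet_setOfPred.1 hE) fun x y hxy => ?_
    exact propext ⟨hmem x y hxy, hmem y x fun i hi => (hxy i hi).symm⟩
  have h2 := hind.measure_inter_preimage_eq_mul {True} B (measurableSet_singleton _) hB
  have h3 : (fun x => x ∈ E) ⁻¹' {True} = E := by ext x; simp
  rw [h3, (measurePreserving_shift P n).measure_preimage hB.nullMeasurableSet] at h2
  rw [h1, h2]

theorem measurePreserving_nextGains (P : Measure ℝ≥0) [IsProbabilityMeasure P] :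
    MeasurePreserving (σ.nextGains M) (Measure.infinitePi fun _ : ℕ => P)
      (Measure.infinitePi fun _ : ℕ => P) := by
  refine ⟨hσ.measurable_nextGains, Measure.ext fun B hB => ?_⟩
  rw [Measure.map_apply hσ.measurable_nextGains hB]
  simpa using hσ.measure_inter_nextGains (M := M) P MeasurableSet.univ hB (by simp)

/-- The strong law of large numbers for functionals of the successive packets. -/
theorem tendsto_packet_average (P : Measure ℝ≥0) [IsProbabilityMeasure P]
    {C : (ℕ → ℝ≥0) → ℝ} (hC : Integrable C (Measure.infinitePi fun _ : ℕ => P))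
    (hCm : Measurable C) (hd : ∀ x y, (∀ i < σ.duration M x, x i = y i) → C y = C x) :
    ∀ᵐ x ∂(Measure.infinitePi fun _ : ℕ => P),
      Tendsto (fun n : ℕ => (∑ i ∈ Finset.range n, C ((σ.nextGains M)^[i] x)) / n) atTop
        (𝓝 (∫ x, C x ∂(Measure.infinitePi fun _ : ℕ => P))) := by
  set ν := Measure.infinitePi fun _ : ℕ => P
  have hpres : ∀ i, MeasurePreserving ((σ.nextGains M)^[i]) ν ν :=
    fun i => (hσ.measurePreserving_nextGains P).iterate i
  -- Pairwise independence is all that the strong law needs. Invariance under the `i`-th iterate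
  -- reduces it to packet `0` against a later packet, where the strong Markov property applies.
  have hlt : ∀ i j, i < j →
      IndepFun (fun x => C ((σ.nextGains M)^[i] x)) (fun x => C ((σ.nextGains M)^[j] x)) ν := by
    intro i j hij
    obtain ⟨k, rfl⟩ : ∃ k, j = k + 1 + i := ⟨j - i - 1, by omega⟩
    rw [indepFun_iff_measure_inter_preimage_eq_mul]
    intro s t hs ht
    have hB : MeasurableSet ((fun x => C ((σ.nextGains M)^[k] x)) ⁻¹' t) :=
      (hCm.comp (hpres k).measurable) ht
    have h1 : (fun x => C ((σ.nextGains M)^[k + 1 + i] x)) ⁻¹' t =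
        (σ.nextGains M)^[i] ⁻¹' (σ.nextGains M ⁻¹'
          ((fun x => C ((σ.nextGains M)^[k] x)) ⁻¹' t)) := by
      ext x
      simp only [Set.mem_preimage, Function.iterate_add_apply, Function.iterate_succ_apply]
    have h2 : (fun x => C ((σ.nextGains M)^[i] x)) ⁻¹' s = (σ.nextGains M)^[i] ⁻¹' (C ⁻¹' s) := rfl
    have hB' := hσ.measurable_nextGains (M := M) hB
    rw [h1, h2, ← Set.preimage_inter,
      (hpres i).measure_preimage ((hCm hs).inter hB').nullMeasurableSet,
      (hpres i).measure_preimage (hCm hs).nullMeasurableSet,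
      (hpres i).measure_preimage hB'.nullMeasurableSet,
      (hσ.measurePreserving_nextGains P).measure_preimage hB.nullMeasurableSet]
    refine hσ.measure_inter_nextGains P (hCm hs) hB fun x y hxy hx => ?_
    rw [Set.mem_preimage] at hx ⊢
    rwa [hd x y hxy]
  refine strong_law_ae_real (fun i x => C ((σ.nextGains M)^[i] x)) hC ?_ ?_
  · intro i j hij
    rcases lt_or_gt_of_ne hij with h | h
    · exact hlt i j h
    · exact (hlt j i h).symm
  · intro i
    refine ⟨(hCm.comp (hpres i).measurable).aemeasurable, hCm.aemeasurable, ?_⟩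
    have := Measure.map_map (μ := ν) hCm (hpres i).measurable
    rw [(hpres i).map_eq] at this
    exact this.symm

end Regular

end Scheme

/-! ### A deterministic renewal argument -/

/-- With `N n` the number of renewals up to `n`, monotonicity gives `S (T (N n)) / T (N n + 1) ≤ S n
/ n ≤ S (T (N n + 1)) / T (N n)`. Both bounds tend to `c / d`, since shifting the index by one costs
only a factor `(k + 1) / k`. -/
theorem tendsto_div_of_renewal {S : ℕ → ℝ} {T : ℕ → ℕ} {c d : ℝ} (hS0 : ∀ n, 0 ≤ S n)
    (hS : Monotone S) (hT : StrictMono T) (hT0 : T 0 = 0) (hd : 0 < d)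
    (hTd : Tendsto (fun n : ℕ => (T n : ℝ) / n) atTop (𝓝 d))
    (hSc : Tendsto (fun n : ℕ => S (T n) / n) atTop (𝓝 c)) :
    Tendsto (fun n : ℕ => S n / n) atTop (𝓝 (c / d)) := by
  classical
  -- Searching up to `n` suffices, because strict monotonicity forces `k ≤ T k`.
  set N : ℕ → ℕ := fun n => Nat.findGreatest (fun k => T k ≤ n) n
  have hN1 : ∀ n, T (N n) ≤ n := fun n =>
    Nat.findGreatest_spec (P := fun k => T k ≤ n) (Nat.zero_le n) (by simp [hT0])
  have hN2 : ∀ n, n < T (N n + 1) := by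
    intro n
    by_contra h
    push Not at h
    have h1 : N n + 1 ≤ n := (hT.id_le _).trans h
    have := Nat.le_findGreatest (P := fun k => T k ≤ n) h1 h
    exact absurd this (Nat.not_succ_le_self _)
  have hNt : Tendsto N atTop atTop := by
    refine tendsto_atTop.2 fun k => ?_
    filter_upwards [eventually_ge_atTop (T k)] with n hn
    by_contra h
    push Not at h
    have := hT.monotone (Nat.succ_le_of_lt h)
    have := hN2 n
    simp only [Nat.succ_eq_add_one] at *
    omega
  have hr : Tendsto (fun k : ℕ => ((k + 1 : ℕ) : ℝ) / k) atTop (𝓝 1) := by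
    have : Tendsto (fun k : ℕ => 1 + 1 / (k : ℝ)) atTop (𝓝 (1 + 0)) :=
      tendsto_const_nhds.add tendsto_one_div_atTop_nhds_zero_nat
    rw [add_zero] at this
    refine this.congr' ?_
    filter_upwards [eventually_gt_atTop 0] with k hk
    have : (k : ℝ) ≠ 0 := by positivity
    push_cast
    field_simp
  have hlow : Tendsto (fun k : ℕ => S (T k) / T (k + 1)) atTop (𝓝 (c / d)) := by
    have h1 := hSc.div ((hTd.comp (tendsto_add_atTop_nat 1)).mul hr) (by simpa using hd.ne')
    rw [mul_one] at h1
    refine h1.congr' ?_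
    filter_upwards [eventually_gt_atTop 0] with k hk
    have hk1 : (k : ℝ) ≠ 0 := by positivity
    have hk2 : ((k + 1 : ℕ) : ℝ) ≠ 0 := by positivity
    have hk3 : (T (k + 1) : ℝ) ≠ 0 := by
      have := hT.id_le (k + 1)
      simp only [id] at this
      exact_mod_cast (by omega : T (k + 1) ≠ 0)
    simp only [Pi.div_apply, Function.comp_apply]
    field_simp
  have hupp : Tendsto (fun k : ℕ => S (T (k + 1)) / T k) atTop (𝓝 (c / d)) := by
    have h1 := ((hSc.comp (tendsto_add_atTop_nat 1)).mul hr).div hTd hd.ne'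
    rw [mul_one] at h1
    refine h1.congr' ?_
    filter_upwards [eventually_gt_atTop 0] with k hk
    have hk1 : (k : ℝ) ≠ 0 := by positivity
    have hk2 : ((k + 1 : ℕ) : ℝ) ≠ 0 := by positivity
    have hk3 : (T k : ℝ) ≠ 0 := by
      have := hT.id_le k
      simp only [id] at this
      exact_mod_cast (by omega : T k ≠ 0)
    simp only [Pi.div_apply, Function.comp_apply]
    field_simp
  refine tendsto_of_tendsto_of_tendsto_of_le_of_le' (hlow.comp hNt) (hupp.comp hNt) ?_ ?_
  · filter_upwards [eventually_gt_atTop 0] with n hn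
    have hn' : (0 : ℝ) < n := by exact_mod_cast hn
    have : (n : ℝ) ≤ T (N n + 1) := by exact_mod_cast (hN2 n).le
    exact div_le_div₀ (hS0 _) (hS (hN1 n)) hn' this
  · filter_upwards [hNt.eventually_gt_atTop 0] with n hn
    have h0 : 0 < T (N n) := by
      have := hT hn
      omega
    have hn' : (0 : ℝ) < T (N n) := by exact_mod_cast h0
    have : (T (N n) : ℝ) ≤ n := by exact_mod_cast hN1 n
    exact div_le_div₀ (hS0 _) (hS (hN2 n).le) hn' this

namespace Scheme

variable {σ : Scheme} {M : ℕ}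

/-! ### The age process -/

theorem age_le (σ : Scheme) (M : ℕ) (x : ℕ → ℝ≥0) (t : ℕ) : σ.age M x t ≤ t := by
  induction t with
  | zero => simp [age]
  | succ t ih =>
    rw [age]
    split_ifs <;> omega

theorem age_eq_self {x : ℕ → ℝ≥0} {t : ℕ} (ht : t < σ.duration M x) : σ.age M x t = t := by
  induction t with
  | zero => simp [age]
  | succ t ih =>
    rw [age, ih (by omega), if_neg]
    simpa using not_endsAt ht

/-- Regeneration: from the end of the first packet on, the process is that of a fresh start on the
remaining gains. The bound `age_le` keeps the truncated subtraction in the packet's starting slot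
harmless. -/
theorem age_duration_add (σ : Scheme) (M : ℕ) (x : ℕ → ℝ≥0) (t : ℕ) :
    σ.age M x (σ.duration M x + t) = σ.age M (σ.nextGains M x) t := by
  induction t with
  | zero =>
    obtain ⟨n, hn⟩ : ∃ n, σ.duration M x = n + 1 := ⟨_, rfl⟩
    have h1 : σ.age M x n = n := age_eq_self (by omega)
    have h2 : σ.endsAt M x n := (duration_eq_iff.1 hn).1
    have h3 : σ.age M (σ.nextGains M x) 0 = 0 := by simp [age]
    rw [hn, add_zero, h3, age, h1, if_pos (by simpa using h2)]
  | succ t ih =>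
    rw [← add_assoc, age, age, ih]
    have h1 := age_le σ M (σ.nextGains M x) t
    have h2 : (fun i => x (σ.duration M x + t - σ.age M (σ.nextGains M x) t + i)) =
        fun i => σ.nextGains M x (t - σ.age M (σ.nextGains M x) t + i) := by
      funext i
      change _ = x _
      congr 1
      omega
    rw [h2]

theorem packetGains_eq_self {x : ℕ → ℝ≥0} {t : ℕ} (ht : t < σ.duration M x) :
    σ.packetGains M x t = x := by
  funext i
  simp [packetGains, age_eq_self ht]

theorem packetGains_duration_add (σ : Scheme) (M : ℕ) (x : ℕ → ℝ≥0) (t : ℕ) :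
    σ.packetGains M x (σ.duration M x + t) = σ.packetGains M (σ.nextGains M x) t := by
  funext i
  have h1 := age_le σ M (σ.nextGains M x) t
  simp only [packetGains, age_duration_add]
  change _ = x _
  congr 1
  omega

/-! ### The renewal-reward theorem -/

/-- The total payoff of a packet, when attempt `m` for a packet that sees the gains `g` pays
`H m g`. -/
noncomputable def packetPayoff (σ : Scheme) (M : ℕ) (H : ℕ → (ℕ → ℝ≥0) → ℝ) (g : ℕ → ℝ≥0) : ℝ :=
  ∑ m ∈ Finset.range (σ.duration M g), H m g

/-- The payoff in slot `t`. -/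
noncomputable def slotPayoff (σ : Scheme) (M : ℕ) (H : ℕ → (ℕ → ℝ≥0) → ℝ) (x : ℕ → ℝ≥0)
    (t : ℕ) : ℝ :=
  H (σ.age M x t) (σ.packetGains M x t)

/-- The slot in which packet number `k` is first sent. -/
noncomputable def renewalTime (σ : Scheme) (M : ℕ) (x : ℕ → ℝ≥0) (k : ℕ) : ℕ :=
  ∑ i ∈ Finset.range k, σ.duration M ((σ.nextGains M)^[i] x)

/-- Slot sums at renewal times are packet sums; by regeneration the first packet can be split off,
so the induction has to vary the gains `x`. -/
theorem sum_slotPayoff_renewalTime (H : ℕ → (ℕ → ℝ≥0) → ℝ) (x : ℕ → ℝ≥0) (k : ℕ) :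
    ∑ t ∈ Finset.range (σ.renewalTime M x k), σ.slotPayoff M H x t =
      ∑ i ∈ Finset.range k, σ.packetPayoff M H ((σ.nextGains M)^[i] x) := by
  induction k generalizing x with
  | zero => simp [renewalTime]
  | succ k ih =>
    have h1 : σ.renewalTime M x (k + 1) =
        σ.duration M x + σ.renewalTime M (σ.nextGains M x) k := by
      simp only [renewalTime, Finset.sum_range_succ', Function.iterate_succ_apply,
        Function.iterate_zero, id]
      rw [add_comm]
    rw [h1, Finset.sum_range_add, Finset.sum_range_succ']
    have h2 : ∀ t, σ.slotPayoff M H x (σ.duration M x + t) =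
        σ.slotPayoff M H (σ.nextGains M x) t := by
      intro t
      simp only [slotPayoff, age_duration_add, packetGains_duration_add]
    simp only [h2, ih, Function.iterate_succ_apply, Function.iterate_zero, id]
    rw [add_comm]
    congr 1
    refine Finset.sum_congr rfl fun t ht => ?_
    have ht := Finset.mem_range.1 ht
    simp only [slotPayoff, age_eq_self ht, packetGains_eq_self ht]

theorem strictMono_renewalTime (σ : Scheme) (M : ℕ) (x : ℕ → ℝ≥0) :
    StrictMono (σ.renewalTime M x) := by
  refine strictMono_nat_of_lt_succ fun k => ?_
  rw [renewalTime, renewalTime, Finset.sum_range_succ]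
  have := duration_pos σ M ((σ.nextGains M)^[k] x)
  omega

theorem Regular.measurable_packetPayoff (hσ : σ.Regular) {H : ℕ → (ℕ → ℝ≥0) → ℝ}
    (hH : ∀ m, Measurable (H m)) : Measurable (σ.packetPayoff M H) := by
  have h : Measurable (fun p : ℕ × (ℕ → ℝ≥0) => ∑ m ∈ Finset.range p.1, H m p.2) :=
    measurable_from_prod_countable_right fun n =>
      Finset.measurable_sum (Finset.range n) fun m _ => hH m
  exact h.comp (hσ.measurable_duration.prodMk measurable_id)

theorem abs_packetPayoff_le (hM : 1 ≤ M) {H : ℕ → (ℕ → ℝ≥0) → ℝ} {B : ℝ}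
    (h0 : ∀ m g, 0 ≤ H m g) (hB : ∀ m < M, ∀ g, H m g ≤ B) (g : ℕ → ℝ≥0) :
    ‖σ.packetPayoff M H g‖ ≤ M * B := by
  have hB0 : 0 ≤ B := (h0 0 g).trans (hB 0 hM g)
  have hD := duration_le (σ := σ) hM g
  rw [packetPayoff, Real.norm_of_nonneg (Finset.sum_nonneg fun m _ => h0 m g)]
  calc ∑ m ∈ Finset.range (σ.duration M g), H m g
      ≤ ∑ m ∈ Finset.range (σ.duration M g), B :=
        Finset.sum_le_sum fun m hm => hB m ((Finset.mem_range.1 hm).trans_le hD) g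
    _ = σ.duration M g * B := by simp
    _ ≤ M * B := by gcongr

theorem Regular.integrable_packetPayoff (hσ : σ.Regular) (hM : 1 ≤ M)
    (ν : Measure (ℕ → ℝ≥0)) [IsProbabilityMeasure ν]
    {H : ℕ → (ℕ → ℝ≥0) → ℝ} {B : ℝ} (hH : ∀ m, Measurable (H m))
    (h0 : ∀ m g, 0 ≤ H m g) (hB : ∀ m < M, ∀ g, H m g ≤ B) :
    Integrable (σ.packetPayoff M H) ν :=
  Integrable.of_bound (hσ.measurable_packetPayoff hH).aestronglyMeasurable (M * B)
    (Eventually.of_forall fun g => abs_packetPayoff_le hM h0 hB g)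

theorem packetPayoff_one (g : ℕ → ℝ≥0) :
    σ.packetPayoff M (fun _ _ => 1) g = σ.duration M g := by
  simp [packetPayoff]

/-- The strong law is applied twice, to the payoff `H` and to the constant payoff `1`, whose packet
total is the duration; the renewal sandwich divides the two limits. -/
theorem Regular.tendsto_slotPayoff (hσ : σ.Regular) (hM : 1 ≤ M) (P : Measure ℝ≥0)
    [IsProbabilityMeasure P] {H : ℕ → (ℕ → ℝ≥0) → ℝ} {B : ℝ} (hH : ∀ m, Measurable (H m))
    (hc : ∀ m g g', (∀ i ≤ m, g i = g' i) → H m g = H m g')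
    (h0 : ∀ m g, 0 ≤ H m g) (hB : ∀ m < M, ∀ g, H m g ≤ B) :
    ∀ᵐ x ∂(Measure.infinitePi fun _ : ℕ => P),
      Tendsto (fun T : ℕ => (∑ t ∈ Finset.range T, σ.slotPayoff M H x t) / (T : ℝ)) atTop
        (𝓝 ((∫ x, σ.packetPayoff M H x ∂(Measure.infinitePi fun _ : ℕ => P)) /
          ∫ x, (σ.duration M x : ℝ) ∂(Measure.infinitePi fun _ : ℕ => P))) := by
  have hdep : ∀ H : ℕ → (ℕ → ℝ≥0) → ℝ, (∀ m g g', (∀ i ≤ m, g i = g' i) → H m g = H m g') →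
      ∀ x y, (∀ i < σ.duration M x, x i = y i) → σ.packetPayoff M H y = σ.packetPayoff M H x := by
    intro H hc x y hxy
    rw [packetPayoff, packetPayoff, hσ.duration_congr hxy]
    refine Finset.sum_congr rfl fun m hm => (hc m x y fun i hi => hxy i ?_).symm
    have := Finset.mem_range.1 hm
    omega
  have hI1 := hσ.integrable_packetPayoff hM (Measure.infinitePi fun _ : ℕ => P)
    (H := fun _ _ => 1) (B := 1) (fun _ => measurable_const) (fun _ _ => zero_le_one)
    (fun _ _ _ => le_rfl)
  have hd : 0 < ∫ x, (σ.duration M x : ℝ) ∂(Measure.infinitePi fun _ : ℕ => P) := by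
    simp only [funext (packetPayoff_one (σ := σ) (M := M))] at hI1
    have : ∫ _, (1 : ℝ) ∂(Measure.infinitePi fun _ : ℕ => P) ≤
        ∫ x, (σ.duration M x : ℝ) ∂(Measure.infinitePi fun _ : ℕ => P) :=
      integral_mono (integrable_const _) hI1 fun x => by
        simp only
        exact_mod_cast duration_pos σ M x
    simp only [integral_const, probReal_univ, smul_eq_mul, mul_one] at this
    linarith
  have h1 := hσ.tendsto_packet_average P hI1
    (hσ.measurable_packetPayoff fun _ => measurable_const) (hdep _ fun _ _ _ _ => rfl)
  have h2 := hσ.tendsto_packet_average P (hσ.integrable_packetPayoff hM _ hH h0 hB)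
    (hσ.measurable_packetPayoff hH) (hdep _ hc)
  filter_upwards [h1, h2] with x hx1 hx2
  simp only [packetPayoff_one] at hx1
  refine tendsto_div_of_renewal (S := fun T => ∑ t ∈ Finset.range T, σ.slotPayoff M H x t)
    (T := σ.renewalTime M x) (fun n => Finset.sum_nonneg fun t _ => h0 _ _) ?_
    (strictMono_renewalTime σ M x) (by simp [renewalTime]) hd ?_ ?_
  · refine monotone_nat_of_le_succ fun n => ?_
    rw [Finset.sum_range_succ]
    exact le_add_of_nonneg_right (h0 _ _)
  · simpa [renewalTime] using hx1
  · simpa only [sum_slotPayoff_renewalTime] using hx2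

end Scheme

/-! ### Measurability, causality and bounds for rewards and powers -/

theorem decoded_congr {proto : Protocol} {R : ℝ} {a b : ℕ → ℝ} {n : ℕ} (h : ∀ t < n, a t = b t) :
    decoded proto R a n ↔ decoded proto R b n := by
  cases proto with
  | ALO => exact exists_congr fun t => and_congr_right fun ht => by rw [h t ht]
  | RTD =>
    simp only [decoded]
    rw [Finset.sum_congr rfl fun t ht => h t (Finset.mem_range.1 ht)]
  | INR =>
    simp only [decoded]
    rw [Finset.sum_congr rfl fun t ht => by rw [h t (Finset.mem_range.1 ht)]]

theorem measurableSet_decoded {α : Type*} [MeasurableSpace α] (proto : Protocol) (R : ℝ)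
    {s : ℕ → α → ℝ} (hs : ∀ t, Measurable (s t)) (n : ℕ) :
    MeasurableSet {x | decoded proto R (fun t => s t x) n} := by
  cases proto with
  | ALO =>
    have : {x | decoded .ALO R (fun t => s t x) n} =
        ⋃ t ∈ Set.Iio n, {x | R ≤ Real.log (1 + s t x)} := by
      ext x
      simp [decoded]
    rw [this]
    exact MeasurableSet.biUnion (Set.to_countable _) fun t _ =>
      measurableSet_le measurable_const ((hs t).const_add 1).log
  | RTD =>
    exact measurableSet_le measurable_const
      ((Finset.measurable_fun_sum _ fun t _ => hs t).const_add 1).log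
  | INR =>
    exact measurableSet_le measurable_const
      (Finset.measurable_fun_sum _ fun t _ => ((hs t).const_add 1).log)

namespace Scheme

variable {σ : Scheme} {M F : ℕ} {proto : Protocol}

theorem Regular.measurable_txPower (hσ : σ.Regular) (m : ℕ) :
    Measurable fun g => σ.txPower g m :=
  (measurable_of_countable (σ.power m)).comp (hσ.measurable m)

theorem Regular.txPower_congr (hσ : σ.Regular) {m : ℕ} {g g' : ℕ → ℝ≥0}
    (h : ∀ i ≤ m, g i = g' i) : σ.txPower g m = σ.txPower g' m := by
  rw [txPower, txPower, hσ.causal m g g' h]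

theorem Regular.measurable_snr (hσ : σ.Regular) (m : ℕ) : Measurable fun g => σ.snr g m :=
  ((measurable_pi_apply m).coe_nnreal_real).mul (hσ.measurable_txPower m)

theorem Regular.snr_congr (hσ : σ.Regular) {m : ℕ} {g g' : ℕ → ℝ≥0}
    (h : ∀ i ≤ m, g i = g' i) : σ.snr g m = σ.snr g' m := by
  rw [snr, snr, hσ.txPower_congr h, h m le_rfl]

open Classical in
/-- The reward earned at attempt `m` for a packet. -/
noncomputable def attemptReward (σ : Scheme) (proto : Protocol) (M : ℕ) (m : ℕ) (g : ℕ → ℝ≥0) : ℝ :=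
  if σ.endsAt M g m ∧ decoded proto σ.rate (σ.snr g) (m + 1) then σ.rate else 0

/-- Only the last attempt for a packet can pay, so this slotwise bookkeeping fits the renewal
theorem. -/
theorem packetPayoff_attemptReward (g : ℕ → ℝ≥0) :
    σ.packetPayoff M (σ.attemptReward proto M) g = σ.reward proto M g := by
  obtain ⟨n, hn⟩ : ∃ n, σ.duration M g = n + 1 := ⟨_, rfl⟩
  rw [packetPayoff, reward, hn, Finset.sum_range_succ, Finset.sum_eq_zero, zero_add, attemptReward]
  · classical exact if_congr (and_iff_right (duration_eq_iff.1 hn).1) rfl rfl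
  · intro m hm
    rw [attemptReward, if_neg]
    exact fun h => not_endsAt (by rw [hn]; simpa using hm) h.1

theorem Regular.measurable_attemptReward (hσ : σ.Regular) (m : ℕ) :
    Measurable (σ.attemptReward proto M m) := by
  classical
  exact Measurable.ite ((hσ.measurableSet_endsAt m).inter
    (measurableSet_decoded proto σ.rate hσ.measurable_snr (m + 1))) measurable_const
    measurable_const

theorem Regular.attemptReward_congr (hσ : σ.Regular) {m : ℕ} {g g' : ℕ → ℝ≥0}
    (h : ∀ i ≤ m, g i = g' i) : σ.attemptReward proto M m g = σ.attemptReward proto M m g' := by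
  have h1 : decoded proto σ.rate (σ.snr g) (m + 1) ↔ decoded proto σ.rate (σ.snr g') (m + 1) :=
    decoded_congr fun t ht => hσ.snr_congr fun i hi => h i (by omega)
  classical exact if_congr (and_congr (hσ.endsAt_congr h) h1) rfl rfl

theorem attemptReward_nonneg (hR : 0 ≤ σ.rate) (m : ℕ) (g : ℕ → ℝ≥0) :
    0 ≤ σ.attemptReward proto M m g := by
  rw [attemptReward]; split_ifs <;> simp [hR]

theorem attemptReward_le (hR : 0 ≤ σ.rate) (m : ℕ) (g : ℕ → ℝ≥0) :
    σ.attemptReward proto M m g ≤ σ.rate := by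
  rw [attemptReward]; split_ifs <;> simp [hR]

/-- Only finitely many powers can occur within `M` attempts, so their sum is a uniform bound; this
makes the cost integrable. -/
theorem Admissible.txPower_le (hσ : σ.Admissible proto M F) {m : ℕ} (hm : m < M) (g : ℕ → ℝ≥0) :
    σ.txPower g m ≤ ∑ k ∈ Finset.range M, ∑ f ∈ Finset.range F, σ.power k f :=
  calc σ.txPower g m ≤ ∑ f ∈ Finset.range F, σ.power m f :=
        Finset.single_le_sum (f := σ.power m) (fun f _ => hσ.power_nonneg m f)
          (Finset.mem_range.2 (hσ.feedback_lt m g))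
    _ ≤ _ := Finset.single_le_sum (f := fun k => ∑ f ∈ Finset.range F, σ.power k f)
          (fun k _ => Finset.sum_nonneg fun f _ => hσ.power_nonneg k f) (Finset.mem_range.2 hm)

end Scheme

/-- Transfers almost sure statements and means from the infinite product measure to `Ω`. -/
theorem map_gains {Ω : Type*} [MeasurableSpace Ω] {μ : Measure Ω} {γ : ℕ → Ω → ℝ≥0}
    (hmeas : ∀ t, Measurable (γ t))
    (hindep : iIndepFun γ μ) (hident : ∀ t, IdentDistrib (γ t) (γ 0) μ μ) :
    μ.map (fun ω i => γ i ω) = Measure.infinitePi fun _ : ℕ => μ.map (γ 0) := by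
  rw [hindep.map_fun_eq_infinitePi_map hmeas]
  congr 1
  funext i
  exact (hident i).map_eq

/-! ### Almost sure throughput and power of admissible schemes -/

section Renewal

variable {Ω : Type*} [MeasurableSpace Ω] {μ : Measure Ω} [IsProbabilityMeasure μ]
  {γ : ℕ → Ω → ℝ≥0} {σ : Scheme} {M F : ℕ} {proto : Protocol}

theorem Scheme.Regular.ae_tendsto_slotPayoff (hmeas : ∀ t, Measurable (γ t))
    (hindep : iIndepFun γ μ) (hident : ∀ t, IdentDistrib (γ t) (γ 0) μ μ)
    (hσ : σ.Regular) (hM : 1 ≤ M) {H : ℕ → (ℕ → ℝ≥0) → ℝ} {B : ℝ} (hH : ∀ m, Measurable (H m))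
    (hc : ∀ m g g', (∀ i ≤ m, g i = g' i) → H m g = H m g')
    (h0 : ∀ m g, 0 ≤ H m g) (hB : ∀ m < M, ∀ g, H m g ≤ B) :
    ∀ᵐ ω ∂μ, Tendsto
      (fun T : ℕ => (∑ t ∈ Finset.range T, σ.slotPayoff M H (fun i => γ i ω) t) / (T : ℝ)) atTop
        (𝓝 ((∫ ω, σ.packetPayoff M H (fun i => γ i ω) ∂μ) / σ.meanTime μ γ M)) := by
  have hΓ : Measurable fun ω i => γ i ω := measurable_pi_iff.2 hmeas
  have := Measure.isProbabilityMeasure_map (hmeas 0).aemeasurable (μ := μ)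
  have h := hσ.tendsto_slotPayoff hM (μ.map (γ 0)) hH hc h0 hB
  rw [← map_gains hmeas hindep hident,
    integral_map hΓ.aemeasurable (hσ.measurable_packetPayoff hH).aestronglyMeasurable,
    integral_map hΓ.aemeasurable (f := fun x => (σ.duration M x : ℝ))
      ((measurable_of_countable (fun n : ℕ => (n : ℝ))).comp
        hσ.measurable_duration).aestronglyMeasurable] at h
  exact ae_of_ae_map hΓ.aemeasurable h

/-- The long-term average power is (mean cost) / (mean inter-renewal time). -/
theorem Scheme.Admissible.hasAveragePower (hmeas : ∀ t, Measurable (γ t))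
    (hindep : iIndepFun γ μ) (hident : ∀ t, IdentDistrib (γ t) (γ 0) μ μ)
    (hσ : σ.Admissible proto M F) (hM : 1 ≤ M) :
    σ.HasAveragePower μ γ M (σ.meanCost μ γ M / σ.meanTime μ γ M) :=
  hσ.regular.ae_tendsto_slotPayoff hmeas hindep hident hM (H := fun m g => σ.txPower g m)
    hσ.regular.measurable_txPower (fun _ _ _ h => hσ.regular.txPower_congr h)
    (fun m _ => hσ.power_nonneg m _) (fun _ hm g => hσ.txPower_le hm g)

/-- The long-term throughput is (mean reward) / (mean inter-renewal time). -/
theorem Scheme.Admissible.hasThroughput (hmeas : ∀ t, Measurable (γ t))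
    (hindep : iIndepFun γ μ) (hident : ∀ t, IdentDistrib (γ t) (γ 0) μ μ)
    (hσ : σ.Admissible proto M F) (hM : 1 ≤ M) :
    σ.HasThroughput μ γ proto M (σ.meanReward μ γ proto M / σ.meanTime μ γ M) := by
  have h := hσ.regular.ae_tendsto_slotPayoff hmeas hindep hident hM
    (H := σ.attemptReward proto M) hσ.regular.measurable_attemptReward
    (fun _ _ _ h => hσ.regular.attemptReward_congr h)
    (attemptReward_nonneg hσ.rate_nonneg) (fun m _ g => attemptReward_le hσ.rate_nonneg m g)
  simp only [packetPayoff_attemptReward] at h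
  exact h

theorem Scheme.HasAveragePower.unique {p q : ℝ} (hp : σ.HasAveragePower μ γ M p)
    (hq : σ.HasAveragePower μ γ M q) : p = q := by
  obtain ⟨ω, h1, h2⟩ := (hp.and hq).exists
  exact tendsto_nhds_unique h1 h2

end Renewal

/-! ### Quotients with values of the denominator in `[0, ∞]` -/

theorem quot_eq (x : ℝ≥0) (a : ℝ≥0∞) : quot x a = x * (a⁻¹).toReal := by
  simp [quot, div_eq_mul_inv, ENNReal.toReal_mul]

theorem quot_nonneg (x : ℝ≥0) (a : ℝ≥0∞) : 0 ≤ quot x a := ENNReal.toReal_nonneg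

theorem measurable_quot (a : ℝ≥0∞) : Measurable fun x => quot x a := by
  simp only [quot_eq]
  exact measurable_coe_nnreal_real.mul_const _

/-- Exchanges the divisors `a` and `r`: this links failure of an attempt (`g / a < ξ`) to the
quantization cells (`g / ξ < a`). For `a = ∞` both sides hold. -/
theorem quot_lt_iff {x : ℝ≥0} {a : ℝ≥0∞} {r : ℝ} (ha : 0 < a) (hr : 0 < r) :
    quot x a < r ↔ ENNReal.ofReal (x / r) < a := by
  induction a with
  | top => simp [quot_eq, hr]
  | coe a =>
    have ha' : (0 : ℝ) < a := by exact_mod_cast ha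
    rw [← ENNReal.ofReal_coe_nnreal, ENNReal.ofReal_lt_ofReal_iff ha', div_lt_iff₀ hr, quot,
      ENNReal.toReal_div, ENNReal.coe_toReal, ENNReal.toReal_ofReal ha'.le, div_lt_iff₀ ha', mul_comm r]

theorem quot_le_quot {x : ℝ≥0} {a b : ℝ≥0∞} (ha : 0 < a) (hab : a ≤ b) :
    quot x b ≤ quot x a := by
  rw [quot_eq, quot_eq]
  have : (b⁻¹).toReal ≤ (a⁻¹).toReal :=
    ENNReal.toReal_mono (by simpa using ha.ne') (ENNReal.inv_le_inv.2 hab)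
  exact mul_le_mul_of_nonneg_left this x.2

theorem quot_min_lt_iff {x : ℝ≥0} {a b : ℝ≥0∞} (ha : 0 < a) (hb : 0 < b) {r : ℝ} :
    quot x (min a b) < r ↔ quot x a < r ∧ quot x b < r := by
  constructor
  · intro h
    exact ⟨(quot_le_quot (lt_min ha hb) (min_le_left _ _)).trans_lt h,
      (quot_le_quot (lt_min ha hb) (min_le_right _ _)).trans_lt h⟩
  · rintro ⟨h1, h2⟩
    rcases min_choice a b with h | h <;> rwa [h]

/-! ### The scaling of the gains -/

theorem exp_sub_one_pos {R : ℝ} (hR : 0 < R) : 0 < Real.exp R - 1 := by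
  have := Real.add_one_lt_exp hR.ne'
  linarith

/-- Two threshold systems are allowed so that `τ` can later be replaced by the thresholds of the
powers actually used. -/
theorem scaling_congr {proto : Protocol} {R : ℝ} {θ θ' : Thresholds} {g g' : ℕ → ℝ≥0} {n : ℕ}
    (h : ∀ t < n, quot (g t) (θ.τ t) = quot (g' t) (θ'.τ t)) :
    scaling proto R θ g n = scaling proto R θ' g' n := by
  cases proto with
  | ALO =>
    simp only [scaling]
    exact Finset.prod_congr rfl fun t ht => by rw [h t (Finset.mem_range.1 ht)]
  | RTD =>
    simp only [scaling]
    rw [Finset.sum_congr rfl fun t ht => h t (Finset.mem_range.1 ht)]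
  | INR =>
    simp only [scaling]
    rw [Finset.prod_congr rfl fun t ht => by rw [h t (Finset.mem_range.1 ht)]]

theorem measurable_scaling (proto : Protocol) (R : ℝ) (θ : Thresholds) (m : ℕ) :
    Measurable fun g => scaling proto R θ g m := by
  have hq : ∀ t, Measurable fun g : ℕ → ℝ≥0 => quot (g t) (θ.τ t) := fun t =>
    (measurable_quot _).comp (measurable_pi_apply t)
  cases proto with
  | ALO =>
    simp only [scaling]
    refine Finset.measurable_fun_prod _ fun t _ => ?_
    exact Measurable.ite (measurableSet_lt measurable_const ((hq t).const_sub 1))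
      measurable_const measurable_const
  | RTD =>
    simp only [scaling]
    exact (Finset.measurable_fun_sum _ fun t _ => hq t).const_sub 1
  | INR =>
    simp only [scaling]
    exact (((Finset.measurable_fun_prod _ fun t _ =>
      ((hq t).const_mul _).const_add 1).const_div _).sub_const 1).mul_const _

theorem scaling_ALO_pos_iff {R : ℝ} {θ : Thresholds} {g : ℕ → ℝ≥0} {m : ℕ} :
    0 < scaling .ALO R θ g m ↔ ∀ t < m, quot (g t) (θ.τ t) < 1 := by
  simp only [scaling]
  constructor
  · intro h t ht
    by_contra hq
    refine h.ne' (Finset.prod_eq_zero (Finset.mem_range.2 ht) (if_neg ?_))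
    simpa using hq
  · intro h
    exact Finset.prod_pos fun t ht => by
      rw [if_pos (sub_pos.2 (h t (Finset.mem_range.1 ht)))]; exact one_pos

theorem scaling_ALO_eq_one {R : ℝ} {θ : Thresholds} {g : ℕ → ℝ≥0} {m : ℕ}
    (h : 0 < scaling .ALO R θ g m) : scaling .ALO R θ g m = 1 := by
  rw [scaling_ALO_pos_iff] at h
  simp only [scaling]
  exact Finset.prod_eq_one fun t ht => if_pos (sub_pos.2 (h t (Finset.mem_range.1 ht)))

theorem inr_prod_pos {R : ℝ} (hR : 0 < R) (θ : Thresholds) (g : ℕ → ℝ≥0) (m : ℕ) :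
    0 < ∏ t ∈ Finset.range m, (1 + (Real.exp R - 1) * quot (g t) (θ.τ t)) :=
  Finset.prod_pos fun t _ => by
    have := mul_nonneg (exp_sub_one_pos hR).le (quot_nonneg (g t) (θ.τ t))
    linarith

/-- `ξ_m` is the value of `q` at which one more factor `1 + (e^R - 1) q` lifts the accumulated
product to exactly `e^R`. -/
theorem lt_scaling_INR_iff {R : ℝ} (hR : 0 < R) {θ : Thresholds} {g : ℕ → ℝ≥0} {m : ℕ} {q : ℝ} :
    q < scaling .INR R θ g m ↔
      (∏ t ∈ Finset.range m, (1 + (Real.exp R - 1) * quot (g t) (θ.τ t))) *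
        (1 + (Real.exp R - 1) * q) < Real.exp R := by
  have hK := exp_sub_one_pos hR
  simp only [scaling]
  rw [mul_one_div, lt_div_iff₀ hK, lt_sub_iff_add_lt, lt_div_iff₀ (inr_prod_pos hR θ g m)]
  ring_nf

theorem scaling_zero_pos {proto : Protocol} {R : ℝ} (hR : 0 < R) (θ : Thresholds) (g : ℕ → ℝ≥0) :
    0 < scaling proto R θ g 0 := by
  cases proto with
  | ALO => simp [scaling]
  | RTD => simp [scaling]
  | INR =>
    rw [lt_scaling_INR_iff hR]
    simpa using hR

/-- The reason for the form of `ξ`, common to all three protocols: something is still missing after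
an attempt iff its contribution stays below what was missing before. Positivity of `ξ_m` is not
assumed, since contributions are nonnegative. -/
theorem scaling_succ_pos_iff {proto : Protocol} {R : ℝ} (hR : 0 < R) {θ : Thresholds}
    {g : ℕ → ℝ≥0} {m : ℕ} :
    0 < scaling proto R θ g (m + 1) ↔ quot (g m) (θ.τ m) < scaling proto R θ g m := by
  cases proto with
  | ALO =>
    constructor
    · intro h
      rw [scaling_ALO_pos_iff] at h
      rw [scaling_ALO_eq_one (scaling_ALO_pos_iff.2 fun t ht => h t (by omega))]
      exact h m (Nat.lt_succ_self m)
    · intro h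
      have h0 := (quot_nonneg _ _).trans_lt h
      rw [scaling_ALO_eq_one h0] at h
      rw [scaling_ALO_pos_iff] at h0 ⊢
      intro t ht
      rcases Nat.lt_succ_iff_lt_or_eq.1 ht with h1 | rfl
      · exact h0 t h1
      · exact h
  | RTD =>
    simp only [scaling, Finset.sum_range_succ]
    constructor <;> intro h <;> linarith
  | INR =>
    rw [lt_scaling_INR_iff hR, lt_scaling_INR_iff hR, Finset.prod_range_succ]
    simp

/-- Decoding, in terms of the scaling. -/
theorem decoded_iff_scaling {proto : Protocol} {R : ℝ} (hR : 0 < R) {θ : Thresholds}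
    {g : ℕ → ℝ≥0} {n : ℕ} :
    decoded proto R (fun t => (Real.exp R - 1) * quot (g t) (θ.τ t)) n ↔
      ¬ 0 < scaling proto R θ g n := by
  have hK := exp_sub_one_pos hR
  have hq : ∀ t, 0 ≤ (Real.exp R - 1) * quot (g t) (θ.τ t) := fun t =>
    mul_nonneg hK.le (quot_nonneg _ _)
  cases proto with
  | ALO =>
    simp only [scaling_ALO_pos_iff, decoded]
    push Not
    refine exists_congr fun t => and_congr_right fun _ => ?_
    rw [Real.le_log_iff_exp_le (by linarith [hq t]), ← sub_le_iff_le_add',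
      le_mul_iff_one_le_right hK]
  | RTD =>
    have := Finset.sum_nonneg fun t (_ : t ∈ Finset.range n) => hq t
    simp only [decoded, scaling]
    rw [Real.le_log_iff_exp_le (by linarith), ← sub_le_iff_le_add', ← Finset.mul_sum,
      le_mul_iff_one_le_right hK, sub_pos, not_lt]
  | INR =>
    rw [lt_scaling_INR_iff hR, mul_zero, add_zero, mul_one, not_lt]
    simp only [decoded]
    rw [← Real.log_prod (fun t _ => (by linarith [hq t] : (0:ℝ) < _).ne'),
      Real.le_log_iff_exp_le (inr_prod_pos hR θ g n)]

/-! ### The feedback -/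

theorem Thresholds.Valid.mono {θ : Thresholds} {M F : ℕ} (hθ : θ.Valid M F) {m : ℕ} (hm : m < M)
    {a b : ℕ} (hab : a ≤ b) (hb : b ≤ F) : θ.s m a ≤ θ.s m b := by
  induction b, hab using Nat.le_induction with
  | base => exact le_rfl
  | succ b _ ih => exact (ih (by omega)).trans ((hθ m hm).2.2.2.2 b (by omega))

section Feedback

variable {proto : Protocol} {M F : ℕ} {R : ℝ} {θ : Thresholds} {g : ℕ → ℝ≥0} {m : ℕ}

theorem quantFeedback_le (proto : Protocol) (F : ℕ) (R : ℝ) (θ : Thresholds) (m : ℕ)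
    (g : ℕ → ℝ≥0) : quantFeedback proto F R θ m g ≤ F - 1 := by
  unfold quantFeedback
  split_ifs
  · exact Nat.findGreatest_le _
  · exact le_rfl

theorem quantFeedback_lt (hF : 1 ≤ F) : quantFeedback proto F R θ m g < F := by
  have := quantFeedback_le proto F R θ m g
  omega

theorem quantFeedback_congr {g' : ℕ → ℝ≥0} (h : ∀ i ≤ m, g i = g' i) :
    quantFeedback proto F R θ m g = quantFeedback proto F R θ m g' := by
  unfold quantFeedback
  rw [scaling_congr (θ' := θ) fun t ht => by rw [h t ht.le], h m le_rfl]

theorem measurable_quantFeedback (proto : Protocol) (F : ℕ) (R : ℝ) (θ : Thresholds) (m : ℕ) :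
    Measurable (quantFeedback proto F R θ m) := by
  classical
  have hs := measurable_scaling proto R θ m
  unfold quantFeedback
  refine Measurable.ite (measurableSet_lt measurable_const hs) ?_ measurable_const
  refine measurable_findGreatest fun f _ => ?_
  exact measurableSet_le measurable_const
    (((measurable_pi_apply m).coe_nnreal_real.div hs).ennreal_ofReal)

theorem quantFeedback_le_iff (hθ : θ.Valid M F) (hF : 1 ≤ F) (hm : m < M)
    (hξ : 0 < scaling proto R θ g m) {f : ℕ} (hf : f < F) :
    quantFeedback proto F R θ m g ≤ f ↔
      ENNReal.ofReal ((g m : ℝ) / scaling proto R θ g m) < θ.s m (f + 1) := by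
  have hb : quantFeedback proto F R θ m g < F := quantFeedback_lt hF
  obtain ⟨h1, h2⟩ := (quantFeedback_eq_iff hθ hm hξ hb).1 rfl
  constructor
  · intro h
    exact h2.trans_le (hθ.mono hm (by omega) (by omega))
  · intro h
    by_contra hlt
    exact absurd (h.trans_le (hθ.mono hm (by omega) (by omega))) (not_lt.2 h1)

/-- The condition on attempt `t` in the event `ptildeEvent`. -/
def Continues (proto : Protocol) (R : ℝ) (θ : Thresholds) (g : ℕ → ℝ≥0) (t : ℕ) : Prop :=
  match proto with
  | .ALO => quot (g t) (min (θ.τ t) (θ.s t 1)) < 1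
  | .RTD => ∑ l ∈ Finset.range t, quot (g l) (θ.τ l) + quot (g t) (min (θ.τ t) (θ.s t 1)) < 1
  | .INR => (∏ l ∈ Finset.range t, (1 + (Real.exp R - 1) * quot (g l) (θ.τ l))) *
        (1 + (Real.exp R - 1) * quot (g t) (min (θ.τ t) (θ.s t 1))) / (1 + (Real.exp R - 1)) < 1

theorem continues_iff (hR : 0 < R) (hξ : 0 < scaling proto R θ g m) :
    Continues proto R θ g m ↔
      quot (g m) (min (θ.τ m) (θ.s m 1)) < scaling proto R θ g m := by
  cases proto with
  | ALO => rw [scaling_ALO_eq_one hξ, Continues]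
  | RTD =>
    simp only [Continues, scaling]
    exact lt_sub_iff_add_lt'.symm
  | INR =>
    rw [lt_scaling_INR_iff hR, Continues, add_sub_cancel, div_lt_one (Real.exp_pos R)]

/-- Given `ξ_m > 0`, the comparison with `s_{m,1}` says that the feedback is `0`, and the comparison
with `τ_m` says that `ξ_{m+1} > 0`; the minimum of the two thresholds imposes both. -/
theorem forall_continues_iff (hR : 0 < R) (hθ : θ.Valid M F) (hF : 1 ≤ F) (hm : m ≤ M) :
    (∀ t < m, Continues proto R θ g t) ↔
      (∀ t < m, quantFeedback proto F R θ t g = 0) ∧ 0 < scaling proto R θ g m := by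
  induction m with
  | zero => simp [scaling_zero_pos hR]
  | succ m ih =>
    rw [Nat.forall_lt_succ_right, ih (by omega), Nat.forall_lt_succ_right, scaling_succ_pos_iff hR]
    have key : 0 < scaling proto R θ g m → (Continues proto R θ g m ↔
        quantFeedback proto F R θ m g = 0 ∧ quot (g m) (θ.τ m) < scaling proto R θ g m) := by
      intro hξ
      obtain ⟨h1, -, h3, -, -⟩ := hθ m hm
      rw [continues_iff hR hξ, quot_min_lt_iff h1 h3, quot_lt_iff h3 hξ, ← Nat.le_zero,
        quantFeedback_le_iff hθ hF hm hξ hF, and_comm]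
    constructor
    · rintro ⟨⟨h1, h2⟩, h3⟩
      rw [key h2] at h3
      exact ⟨⟨h1, h3.1⟩, h3.2⟩
    · rintro ⟨⟨h1, h2⟩, h3⟩
      -- Positivity of `ξ_{m+1}` implies that of `ξ_m`, so it need be recorded at the last index
      -- only.
      have h4 := (quot_nonneg _ _).trans_lt h3
      exact ⟨⟨h1, h4⟩, (key h4).2 ⟨h2, h3⟩⟩

theorem ptildeEvent_iff (hR : 0 < R) (hθ : θ.Valid M F) (hF : 1 ≤ F) (hm : m ≤ M) (a : ℝ≥0∞) :
    ptildeEvent proto R θ g m a ↔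
      ((∀ t < m, quantFeedback proto F R θ t g = 0) ∧ 0 < scaling proto R θ g m) ∧
        ENNReal.ofReal ((g m : ℝ) / scaling proto R θ g m) < a := by
  rw [← forall_continues_iff hR hθ hF hm]
  cases proto with
  | ALO =>
    refine and_congr_right fun h => ?_
    have h1 := ((forall_continues_iff (proto := .ALO) hR hθ hF hm).1 h).2
    rw [scaling_ALO_eq_one h1, div_one, ENNReal.ofReal_coe_nnreal]
  | RTD => rfl
  | INR => rfl

theorem ptildeEvent_feedback_iff (hR : 0 < R) (hθ : θ.Valid M F) (hm : m < M) {f : ℕ}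
    (hf : f + 1 < F) :
    ptildeEvent proto R θ g m (θ.s m (f + 1)) ↔
      (∀ t < m, quantFeedback proto F R θ t g = 0) ∧ quantFeedback proto F R θ m g ≤ f := by
  have hF : 1 ≤ F := by omega
  rw [ptildeEvent_iff hR hθ hF hm.le, and_assoc]
  refine and_congr_right fun _ => ?_
  by_cases hξ : 0 < scaling proto R θ g m
  · rw [quantFeedback_le_iff hθ hF hm hξ (by omega)]
    simp [hξ]
  -- If nothing is missing, the feedback is `F - 1`, which exceeds `f` because `f + 1 < F`; so
  -- feedback at most `f` already forces `ξ_m > 0`.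
  · have : quantFeedback proto F R θ m g = F - 1 := by
      unfold quantFeedback
      rw [if_neg hξ]
    simp only [hξ, false_and, this, false_iff]
    omega

end Feedback

/-! ### The proposed scheme -/

section Proposed

variable {proto : Protocol} {M F : ℕ} {R : ℝ} {θ : Thresholds} {g : ℕ → ℝ≥0} {m n : ℕ}

theorem proposed_snr_eq (proto : Protocol) (F : ℕ) (R : ℝ) (θ : Thresholds) (g : ℕ → ℝ≥0) :
    (proposed proto F R θ).snr g = fun t => (Real.exp R - 1) * quot (g t)
      (if quantFeedback proto F R θ t g = 0 then θ.τ t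
        else θ.s t (quantFeedback proto F R θ t g)) := by
  funext t
  simp only [Scheme.snr, Scheme.txPower, proposed, quot_eq]
  ring

theorem proposed_decoded_of_zero (hR : 0 < R)
    (h : ∀ t < n, quantFeedback proto F R θ t g = 0) :
    decoded proto R ((proposed proto F R θ).snr g) n ↔ ¬ 0 < scaling proto R θ g n := by
  rw [← decoded_iff_scaling hR]
  refine decoded_congr fun t ht => ?_
  simp only [proposed_snr_eq, if_pos (h t ht)]

/-- Cell `f` starts at `s_{m,f}`, so `g / ξ ≥ s_{m,f}` and the power `(e^R - 1) / s_{m,f}` supplies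
at least what is missing. If `ξ_m ≤ 0`, any power will do. -/
theorem proposed_decoded_of_ne_zero (hR : 0 < R) (hθ : θ.Valid M F) (hF : 1 ≤ F) (hm : m < M)
    (h : ∀ t < m, quantFeedback proto F R θ t g = 0) (hne : quantFeedback proto F R θ m g ≠ 0) :
    decoded proto R ((proposed proto F R θ).snr g) (m + 1) := by
  -- For the given gains, the powers used are those of a scheme with these effective `τ`; they agree
  -- with `θ.τ` before attempt `m`.
  rw [proposed_snr_eq, decoded_iff_scaling (θ := ⟨fun t => if quantFeedback proto F R θ t g = 0
    then θ.τ t else θ.s t (quantFeedback proto F R θ t g), θ.s⟩) hR, scaling_succ_pos_iff hR,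
    scaling_congr (θ' := θ) (g' := g) fun t ht => by simp only [if_pos (h t ht)]]
  simp only [if_neg hne]
  by_cases hξ : 0 < scaling proto R θ g m
  · have hb : quantFeedback proto F R θ m g < F := quantFeedback_lt hF
    have hpos : 0 < θ.s m (quantFeedback proto F R θ m g) :=
      (hθ m hm).2.2.1.trans_le (hθ.mono hm (by omega) hb.le)
    rw [quot_lt_iff hpos hξ, not_lt]
    exact ((quantFeedback_eq_iff hθ hm hξ hb).1 rfl).1
  · exact fun h => hξ ((quot_nonneg _ _).trans_lt h)

theorem proposed_endsAt_iff (hm : m + 1 < M) :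
    (proposed proto F R θ).endsAt M g m ↔ quantFeedback proto F R θ m g ≠ 0 := by
  rw [Scheme.endsAt, or_iff_left (by omega)]
  rfl

theorem lt_proposed_duration_iff (hm : m < M) :
    m < (proposed proto F R θ).duration M g ↔ ∀ t < m, quantFeedback proto F R θ t g = 0 := by
  rw [Scheme.lt_duration_iff]
  refine forall₂_congr fun t ht => ?_
  rw [proposed_endsAt_iff (by omega), not_not]

theorem proposed_admissible (hR : 0 < R) (hθ : θ.Valid M F) (hF : 1 ≤ F) :
    (proposed proto F R θ).Admissible proto M F where
  rate_nonneg := hR.le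
  feedback_lt _ _ := quantFeedback_lt hF
  feedback_measurable m := measurable_quantFeedback proto F R θ m
  feedback_causal _ _ _ h := quantFeedback_congr h
  power_nonneg _ _ := mul_nonneg (exp_sub_one_pos hR).le ENNReal.toReal_nonneg
  decoded_of_early_end g h := by
    obtain ⟨n, hn⟩ : ∃ n, (proposed proto F R θ).duration M g = n + 1 := ⟨_, rfl⟩
    rw [hn] at h ⊢
    have h1 := (Scheme.duration_eq_iff.1 hn).1
    rw [proposed_endsAt_iff h] at h1
    have h2 : ∀ t < n, quantFeedback proto F R θ t g = 0 :=
      (lt_proposed_duration_iff (M := M) (by omega)).1 (by omega)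
    exact proposed_decoded_of_ne_zero hR hθ hF (by omega) h2 h1

theorem proposed_not_decoded_iff (hR : 0 < R) (hθ : θ.Valid M F) (hM : 1 ≤ M) (hF : 1 ≤ F) :
    ¬ decoded proto R ((proposed proto F R θ).snr g) ((proposed proto F R θ).duration M g) ↔
      (∀ t < M, quantFeedback proto F R θ t g = 0) ∧
        ¬ decoded proto R ((proposed proto F R θ).snr g) M := by
  have hD : (proposed proto F R θ).duration M g ≤ M := Scheme.duration_le hM g
  obtain ⟨n, rfl⟩ : ∃ n, M = n + 1 := ⟨M - 1, by omega⟩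
  constructor
  · intro h
    have hDM : (proposed proto F R θ).duration (n + 1) g = n + 1 := by
      by_contra hne
      exact h ((proposed_admissible hR hθ hF).decoded_of_early_end g (by omega))
    rw [hDM] at h
    have h0 : ∀ t < n, quantFeedback proto F R θ t g = 0 :=
      (lt_proposed_duration_iff (M := n + 1) (by omega)).1 (by omega)
    refine ⟨fun t ht => ?_, h⟩
    rcases Nat.lt_succ_iff_lt_or_eq.1 ht with h1 | rfl
    · exact h0 t h1
    · by_contra hne
      exact h (proposed_decoded_of_ne_zero hR hθ hF ht h0 hne)
  · rintro ⟨h1, h2⟩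
    have : n < (proposed proto F R θ).duration (n + 1) g :=
      (lt_proposed_duration_iff (Nat.lt_succ_self n)).2 fun t ht => h1 t (by omega)
    rwa [show (proposed proto F R θ).duration (n + 1) g = n + 1 by omega]

theorem ptildeEvent_outage_iff (hR : 0 < R) (hθ : θ.Valid M F) (hF : 1 ≤ F) :
    ptildeEvent proto R θ g M ⊤ ↔
      (∀ t < M, quantFeedback proto F R θ t g = 0) ∧
        ¬ decoded proto R ((proposed proto F R θ).snr g) M := by
  rw [ptildeEvent_iff hR hθ hF le_rfl, and_iff_left ENNReal.ofReal_lt_top]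
  refine and_congr_right fun h => ?_
  rw [proposed_decoded_of_zero hR h, not_not]

end Proposed

/-! ### Probabilities and means of the proposed scheme -/

section Means

variable {Ω : Type*} [MeasurableSpace Ω] {μ : Measure Ω}
  {γ : ℕ → Ω → ℝ≥0} {proto : Protocol} {M F : ℕ} {R : ℝ} {θ : Thresholds}

theorem pProb_of_lt {m f : ℕ} (hf : f + 1 < F) :
    pProb μ γ proto F R θ m f = ptilde μ γ proto R θ m (θ.s m (f + 1)) := by
  cases m <;> simp [pProb, hf]

/-- For `f = F - 1` the bound on the feedback is void, leaving the event that all earlier feedback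
is `0`; this explains `p_{m,F-1} = p_{m-1,0}`. -/
theorem measureReal_feedback_le [IsProbabilityMeasure μ] (hR : 0 < R) (hθ : θ.Valid M F) (hF : 1 ≤ F) {m : ℕ} (hm : m < M)
    {f : ℕ} (hf : f < F) :
    μ.real {ω | (∀ t < m, quantFeedback proto F R θ t (fun i => γ i ω) = 0) ∧
        quantFeedback proto F R θ m (fun i => γ i ω) ≤ f} = pProb μ γ proto F R θ m f := by
  induction m generalizing f with
  | zero =>
    by_cases h : f + 1 < F
    · rw [pProb_of_lt h, ptilde]
      simp only [ptildeEvent_feedback_iff hR hθ hm h]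
    · have h1 : ∀ g, quantFeedback proto F R θ 0 g ≤ f := fun g =>
        (quantFeedback_le proto F R θ 0 g).trans (by omega)
      simp [pProb, h, h1]
  | succ m ih =>
    by_cases h : f + 1 < F
    · rw [pProb_of_lt h, ptilde]
      simp only [ptildeEvent_feedback_iff hR hθ hm h]
    · have h1 : ∀ g, quantFeedback proto F R θ (m + 1) g ≤ f := fun g =>
        (quantFeedback_le proto F R θ _ g).trans (by omega)
      rw [pProb, if_neg h, ← ih (by omega) (by omega : 0 < F)]
      simp only [h1, and_true, Nat.forall_lt_succ_right, Nat.le_zero]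

theorem measureReal_outage (hR : 0 < R) (hθ : θ.Valid M F) (hF : 1 ≤ F) :
    μ.real {ω | (∀ t < M, quantFeedback proto F R θ t (fun i => γ i ω) = 0) ∧
        ¬ decoded proto R ((proposed proto F R θ).snr (fun i => γ i ω)) M} =
      pOut μ γ proto M R θ := by
  rw [pOut, ptilde]
  simp only [ptildeEvent_outage_iff hR hθ hF]

theorem measurableSet_active (hmeas : ∀ t, Measurable (γ t)) (m : ℕ) :
    MeasurableSet {ω | ∀ t < m, quantFeedback proto F R θ t (fun i => γ i ω) = 0} := by
  have : {ω | ∀ t < m, quantFeedback proto F R θ t (fun i => γ i ω) = 0} =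
      ⋂ t ∈ Set.Iio m, {ω | quantFeedback proto F R θ t (fun i => γ i ω) = 0} := by
    ext ω; simp
  rw [this]
  exact MeasurableSet.biInter (Set.to_countable _) fun t _ =>
    ((measurable_quantFeedback proto F R θ t).comp (measurable_pi_iff.2 hmeas))
      (measurableSet_singleton 0)

theorem measurableSet_feedback (hmeas : ∀ t, Measurable (γ t)) (m : ℕ) (s : Set ℕ) :
    MeasurableSet {ω | quantFeedback proto F R θ m (fun i => γ i ω) ∈ s} :=
  ((measurable_quantFeedback proto F R θ m).comp (measurable_pi_iff.2 hmeas))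
    (MeasurableSet.of_discrete (s := s))

theorem measureReal_active_succ [IsProbabilityMeasure μ] (hR : 0 < R) (hθ : θ.Valid M F) (hF : 1 ≤ F) {m : ℕ} (hm : m < M) :
    μ.real {ω | ∀ t < m + 1, quantFeedback proto F R θ t (fun i => γ i ω) = 0} =
      pProb μ γ proto F R θ m 0 := by
  rw [← measureReal_feedback_le hR hθ hF hm hF]
  simp only [Nat.forall_lt_succ_right, Nat.le_zero]

theorem measureReal_feedback_eq [IsProbabilityMeasure μ] (hmeas : ∀ t, Measurable (γ t)) (hR : 0 < R) (hθ : θ.Valid M F)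
    (hF : 1 ≤ F) {m : ℕ} (hm : m < M) {f : ℕ} (hf : f + 1 < F) :
    μ.real {ω | (∀ t < m, quantFeedback proto F R θ t (fun i => γ i ω) = 0) ∧
        quantFeedback proto F R θ m (fun i => γ i ω) = f + 1} =
      pProb μ γ proto F R θ m (f + 1) - pProb μ γ proto F R θ m f := by
  rw [← measureReal_feedback_le hR hθ hF hm hf,
    ← measureReal_feedback_le hR hθ hF hm (by omega : f < F), ← measureReal_sdiff]
  · congr 1
    ext ω
    simp only [Set.mem_sdiff, Set.mem_ofPred_eq]
    constructor
    · rintro ⟨h1, h2⟩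
      exact ⟨⟨h1, h2.le⟩, fun h => by omega⟩
    · rintro ⟨⟨h1, h2⟩, h3⟩
      refine ⟨h1, ?_⟩
      by_contra hne
      exact h3 ⟨h1, by omega⟩
  · rintro ω ⟨h1, h2⟩
    exact ⟨h1, h2.trans (Nat.le_succ f)⟩
  · exact (measurableSet_active hmeas m).inter (measurableSet_feedback hmeas m (Set.Iic f))

open Classical in
-- Trades the random number of summands for indicators over `M` fixed attempts, so that the integral
-- can be taken termwise.
theorem packetPayoff_proposed (hM : 1 ≤ M) (H : ℕ → (ℕ → ℝ≥0) → ℝ) (g : ℕ → ℝ≥0) :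
    (proposed proto F R θ).packetPayoff M H g = ∑ m ∈ Finset.range M,
      if ∀ t < m, quantFeedback proto F R θ t g = 0 then H m g else 0 := by
  have hD : (proposed proto F R θ).duration M g ≤ M := Scheme.duration_le hM g
  rw [Scheme.packetPayoff, ← Finset.sum_filter]
  refine Finset.sum_congr ?_ fun _ _ => rfl
  ext m
  simp only [Finset.mem_range, Finset.mem_filter]
  constructor
  · intro h
    exact ⟨h.trans_le hD, (lt_proposed_duration_iff (h.trans_le hD)).1 h⟩
  · rintro ⟨h1, h2⟩
    exact (lt_proposed_duration_iff h1).2 h2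

theorem proposed_meanTime [IsProbabilityMeasure μ] (hmeas : ∀ t, Measurable (γ t)) (hR : 0 < R) (hθ : θ.Valid M F)
    (hM : 1 ≤ M) (hF : 1 ≤ F) :
    (proposed proto F R θ).meanTime μ γ M = timeSum μ γ proto M F R θ := by
  classical
  have hA := fun m => measurableSet_active (proto := proto) (F := F) (R := R) (θ := θ) hmeas m
  simp only [Scheme.meanTime, ← Scheme.packetPayoff_one, packetPayoff_proposed hM]
  have hind : ∀ m, (fun ω => if ∀ t < m, quantFeedback proto F R θ t (fun i => γ i ω) = 0
      then (1 : ℝ) else 0) =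
      {ω | ∀ t < m, quantFeedback proto F R θ t (fun i => γ i ω) = 0}.indicator 1 := by
    intro m
    funext ω
    simp [Set.indicator_apply]
  rw [integral_finsetSum]
  · simp only [hind, integral_indicator_one (hA _)]
    obtain ⟨n, rfl⟩ : ∃ n, M = n + 1 := ⟨M - 1, by omega⟩
    rw [timeSum, Finset.sum_range_succ', add_comm, Nat.add_sub_cancel]
    congr 1
    · simp
    · refine Finset.sum_congr rfl fun m hm => measureReal_active_succ hR hθ hF ?_
      have := Finset.mem_range.1 hm
      omega
  · intro m _
    rw [hind]
    exact (integrable_const (1 : ℝ)).indicator (hA m)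

theorem proposed_meanCost [IsProbabilityMeasure μ] (hmeas : ∀ t, Measurable (γ t)) (hR : 0 < R) (hθ : θ.Valid M F)
    (hM : 1 ≤ M) (hF : 1 ≤ F) :
    (proposed proto F R θ).meanCost μ γ M =
      (Real.exp R - 1) * powerSum μ γ proto M F R θ := by
  classical
  set σ := proposed proto F R θ with hσ
  have hcost : ∀ g, σ.cost M g = ∑ m ∈ Finset.range M, ∑ f ∈ Finset.range F,
      if (∀ t < m, quantFeedback proto F R θ t g = 0) ∧ quantFeedback proto F R θ m g = f
        then σ.power m f else 0 := by
    intro g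
    have h1 := packetPayoff_proposed (proto := proto) (F := F) (R := R) (θ := θ) hM
      (fun m g => σ.txPower g m) g
    refine h1.trans (Finset.sum_congr rfl fun m _ => ?_)
    simp only [ite_and]
    split_ifs with h
    · rw [Finset.sum_ite_eq (Finset.range F), if_pos (Finset.mem_range.2 (quantFeedback_lt hF))]
      rfl
    · simp
  have hE : ∀ m f, MeasurableSet {ω | (∀ t < m, quantFeedback proto F R θ t (fun i => γ i ω) = 0) ∧
      quantFeedback proto F R θ m (fun i => γ i ω) = f} := fun m f =>
    (measurableSet_active hmeas m).inter (measurableSet_feedback hmeas m {f})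
  have hind : ∀ m f, (fun ω => if (∀ t < m, quantFeedback proto F R θ t (fun i => γ i ω) = 0) ∧
      quantFeedback proto F R θ m (fun i => γ i ω) = f then σ.power m f else 0) =
      {ω | (∀ t < m, quantFeedback proto F R θ t (fun i => γ i ω) = 0) ∧
        quantFeedback proto F R θ m (fun i => γ i ω) = f}.indicator fun _ => σ.power m f := by
    intro m f
    funext ω
    simp [Set.indicator_apply]
  have hint : ∀ m f, Integrable (fun ω => if (∀ t < m, quantFeedback proto F R θ t
      (fun i => γ i ω) = 0) ∧ quantFeedback proto F R θ m (fun i => γ i ω) = f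
      then σ.power m f else 0) μ := by
    intro m f
    rw [hind]
    exact (integrable_const _).indicator (hE m f)
  simp only [Scheme.meanCost, hcost]
  rw [integral_finsetSum _ fun m _ => integrable_finsetSum _ fun f _ => hint m f, powerSum,
    Finset.mul_sum]
  refine Finset.sum_congr rfl fun m hm => ?_
  have hm := Finset.mem_range.1 hm
  rw [integral_finsetSum _ fun f _ => hint m f]
  simp only [hind, integral_indicator_const _ (hE _ _), smul_eq_mul]
  -- The term `f = 0` is split off, as its power involves `τ_m` instead of `s_{m,0} = 0`.
  rw [Finset.range_eq_Ico, Finset.sum_eq_sum_Ico_succ_bot (by omega : 0 < F), zero_add, add_comm,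
    mul_add, Finset.mul_sum]
  congr 1
  · refine Finset.sum_congr rfl fun f hf => ?_
    obtain ⟨h1, h2⟩ := Finset.mem_Ico.1 hf
    obtain ⟨k, rfl⟩ : ∃ k, f = k + 1 := ⟨f - 1, by omega⟩
    rw [measureReal_feedback_eq hmeas hR hθ hF hm h2]
    simp only [hσ, proposed, Nat.succ_ne_zero, if_false, Nat.add_sub_cancel]
    ring
  · rw [← measureReal_feedback_le hR hθ hF hm (by omega : 0 < F)]
    simp only [hσ, proposed, Nat.le_zero, if_true]
    ring

theorem proposed_meanReward [IsProbabilityMeasure μ] (hmeas : ∀ t, Measurable (γ t)) (hR : 0 < R) (hθ : θ.Valid M F)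
    (hM : 1 ≤ M) (hF : 1 ≤ F) :
    (proposed proto F R θ).meanReward μ γ proto M = R * (1 - pOut μ γ proto M R θ) := by
  classical
  set E := {ω | (∀ t < M, quantFeedback proto F R θ t (fun i => γ i ω) = 0) ∧
    ¬ decoded proto R ((proposed proto F R θ).snr (fun i => γ i ω)) M} with hE
  have hEm : MeasurableSet E := (measurableSet_active hmeas M).inter
    ((measurableSet_decoded proto R
      (proposed_admissible (proto := proto) hR hθ hF).regular.measurable_snr M).preimage
        (measurable_pi_iff.2 hmeas)).compl
  have hrew : ∀ ω, (proposed proto F R θ).reward proto M (fun i => γ i ω) =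
      Eᶜ.indicator (fun _ => R) ω := by
    intro ω
    have h := proposed_not_decoded_iff (proto := proto) (g := fun i => γ i ω) hR hθ hM hF
    rw [Scheme.reward, Set.indicator_apply]
    refine if_congr ?_ rfl rfl
    rw [Set.mem_compl_iff, hE, Set.mem_ofPred_eq, ← h, not_not]
    rfl
  simp only [Scheme.meanReward, hrew]
  rw [integral_indicator_const _ hEm.compl, probReal_compl_eq_one_sub hEm,
    measureReal_outage hR hθ hF, smul_eq_mul, mul_comm]

theorem pProb_nonneg (m f : ℕ) : 0 ≤ pProb μ γ proto F R θ m f := by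
  induction m generalizing f with
  | zero => rw [pProb]; split_ifs; exacts [measureReal_nonneg, zero_le_one]
  | succ m ih => rw [pProb]; split_ifs; exacts [measureReal_nonneg, ih 0]

theorem timeSum_pos : 0 < timeSum μ γ proto M F R θ :=
  add_pos_of_pos_of_nonneg one_pos (Finset.sum_nonneg fun m _ => pProb_nonneg m 0)

/-- Read off from the mean cost, which is an integral of nonnegative powers. -/
theorem powerSum_nonneg [IsProbabilityMeasure μ] (hmeas : ∀ t, Measurable (γ t)) (hR : 0 < R) (hθ : θ.Valid M F)
    (hM : 1 ≤ M) (hF : 1 ≤ F) : 0 ≤ powerSum μ γ proto M F R θ := by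
  have h : 0 ≤ (proposed proto F R θ).meanCost μ γ M :=
    integral_nonneg fun ω => Finset.sum_nonneg fun m _ =>
      (proposed_admissible (proto := proto) hR hθ hF).power_nonneg m _
  rw [proposed_meanCost hmeas hR hθ hM hF] at h
  exact nonneg_of_mul_nonneg_right h (exp_sub_one_pos hR)

theorem mean_power_eq_iff {Pbar : ℝ} (hP : 0 < Pbar) (hR : 0 < R)
    (hD : 0 ≤ powerSum μ γ proto M F R θ) :
    (Real.exp R - 1) * powerSum μ γ proto M F R θ / timeSum μ γ proto M F R θ = Pbar ↔
      R = rateFormula μ γ proto M F Pbar R θ := by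
  have hE : 0 < timeSum μ γ proto M F R θ := timeSum_pos
  rw [rateFormula]
  rcases hD.eq_or_lt with h0 | hpos
  -- With `D = 0` both sides fail: division by zero makes the mean power and the logarithm `0`,
  -- whereas `Pbar` and `R` are positive.
  · rw [← h0]
    simp [hP.ne, hR.ne']
  · rw [← Real.exp_eq_exp (x := R), Real.exp_log (by positivity), div_eq_iff hE.ne',
      ← sub_eq_iff_eq_add', ← mul_div_assoc, eq_div_iff hpos.ne']

theorem rateFormula_pos {Pbar : ℝ} (hP : 0 < Pbar) (hD : 0 < powerSum μ γ proto M F R θ) :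
    0 < rateFormula μ γ proto M F Pbar R θ := by
  have hE : 0 < timeSum μ γ proto M F R θ := timeSum_pos
  refine Real.log_pos ?_
  have : 0 < Pbar * (timeSum μ γ proto M F R θ / powerSum μ γ proto M F R θ) := by positivity
  linarith

end Means

/-! ### Independence of the rate and closed form for ALO -/

section Closed

variable {Ω : Type*} [MeasurableSpace Ω] {μ : Measure Ω}
  {γ : ℕ → Ω → ℝ≥0} {proto : Protocol} {M F : ℕ} {θ : Thresholds}

theorem ptilde_rate (h : proto ≠ .INR) (R R' : ℝ) (m : ℕ) (a : ℝ≥0∞) :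
    ptilde μ γ proto R θ m a = ptilde μ γ proto R' θ m a := by
  cases proto with
  | ALO => rfl
  | RTD => rfl
  | INR => exact absurd rfl h

theorem pProb_rate (h : proto ≠ .INR) (R R' : ℝ) (m f : ℕ) :
    pProb μ γ proto F R θ m f = pProb μ γ proto F R' θ m f := by
  induction m generalizing f with
  | zero => simp only [pProb, ptilde_rate h R R']
  | succ m ih => simp only [pProb, ptilde_rate h R R', ih]

theorem rateFormula_rate (h : proto ≠ .INR) (Pbar R R' : ℝ) :
    rateFormula μ γ proto M F Pbar R θ = rateFormula μ γ proto M F Pbar R' θ := by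
  simp only [rateFormula, timeSum, powerSum, pProb_rate h R R']

theorem throughputFormula_rate (h : proto ≠ .INR) (Pbar R R' : ℝ) :
    throughputFormula μ γ proto M F Pbar R θ = throughputFormula μ γ proto M F Pbar R' θ := by
  rw [throughputFormula, throughputFormula, rateFormula_rate h Pbar R R']
  simp only [timeSum, pProb_rate h R R', pOut, ptilde_rate h R R']

theorem ptilde_ALO (hindep : iIndepFun γ μ)
    (hident : ∀ t, IdentDistrib (γ t) (γ 0) μ μ) (hθ : θ.Valid M F) (R : ℝ) {m : ℕ} (hm : m ≤ M)
    (a : ℝ≥0∞) :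
    ptilde μ γ .ALO R θ m a =
      (∏ t ∈ Finset.range m, μ.real {ω | (γ 0 ω : ℝ≥0∞) < min (θ.τ t) (θ.s t 1)}) *
        μ.real {ω | (γ 0 ω : ℝ≥0∞) < a} := by
  -- For ALO the conditions bound each gain separately; collecting the bounds, with `a` at index
  -- `m`, exhibits the event as an intersection of independent ones.
  set b : ℕ → ℝ≥0∞ := fun t => if t < m then min (θ.τ t) (θ.s t 1) else a
  have hS : ∀ c : ℝ≥0∞, MeasurableSet {x : ℝ≥0 | (x : ℝ≥0∞) < c} := fun c =>
    measurableSet_lt measurable_coe_nnreal_ennreal measurable_const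
  have h1 : {ω | ptildeEvent .ALO R θ (fun i => γ i ω) m a} =
      ⋂ t ∈ Finset.range (m + 1), γ t ⁻¹' {x : ℝ≥0 | (x : ℝ≥0∞) < b t} := by
    ext ω
    simp only [ptildeEvent, Set.mem_ofPred_eq, Set.mem_iInter, Set.mem_preimage, Finset.mem_range,
      Nat.forall_lt_succ_right, b, lt_irrefl, if_false]
    refine and_congr_left fun _ => forall₂_congr fun t ht => ?_
    obtain ⟨h1, -, h3, -⟩ := hθ t (ht.trans_le hm)
    rw [if_pos ht, quot_lt_iff (lt_min h1 h3) one_pos, div_one, ENNReal.ofReal_coe_nnreal]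
  have h2 : ∀ t c, μ (γ t ⁻¹' {x : ℝ≥0 | (x : ℝ≥0∞) < c}) = μ {ω | (γ 0 ω : ℝ≥0∞) < c} :=
    fun t c => (hident t).measure_mem_eq (hS c)
  rw [ptilde, measureReal_def, h1,
    hindep.measure_inter_preimage_eq_mul _ fun t _ => hS (b t), ENNReal.toReal_prod,
    Finset.prod_range_succ]
  simp only [h2]
  congr 1
  · refine Finset.prod_congr rfl fun t ht => ?_
    simp only [b, if_pos (Finset.mem_range.1 ht)]
    rfl
  · simp only [b, lt_irrefl, if_false]
    rfl

theorem measureReal_lt_eq_le [IsProbabilityMeasure μ] {X : Ω → ℝ≥0}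
    (h : ∀ x : ℝ≥0, μ {ω | X ω = x} = 0) (a : ℝ≥0∞) :
    μ.real {ω | (X ω : ℝ≥0∞) < a} = μ.real {ω | (X ω : ℝ≥0∞) ≤ a} := by
  refine measureReal_congr ?_
  induction a with
  | top => simp
  | coe a =>
    have : ∀ᵐ ω ∂μ, X ω ≠ a := by simpa [ae_iff] using h a
    filter_upwards [this] with ω hω
    refine propext ⟨fun h => le_of_lt h, fun h => lt_of_le_of_ne h ?_⟩
    exact_mod_cast hω

end Closed

end HARQ

/-! ### The throughput formula and the lower bounds -/

theorem mainTheorem1 {Ω : Type*} [MeasurableSpace Ω] (μ : Measure Ω) [IsProbabilityMeasure μ]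
    (γ : ℕ → Ω → ℝ≥0) (hmeas : ∀ t, Measurable (γ t)) (hindep : iIndepFun γ μ)
    (hident : ∀ t, IdentDistrib (γ t) (γ 0) μ μ)
    (proto : HARQ.Protocol) (M F : ℕ) (hM : 1 ≤ M) (hF : 1 ≤ F) (Pbar : ℝ) (hP : 0 < Pbar) :
    -- for every rate and every choice of thresholds
    (∀ (R : ℝ) (θ : HARQ.Thresholds), 0 < R → θ.Valid M F →
      -- the proposed scheme is admissible
      (HARQ.proposed proto F R θ).Admissible proto M F ∧
      -- the probabilities of the feedback events
      (∀ m < M, ∀ f < F,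
        μ.real {ω | (∀ t < m, HARQ.quantFeedback proto F R θ t (fun i => γ i ω) = 0) ∧
            HARQ.quantFeedback proto F R θ m (fun i => γ i ω) ≤ f} =
          HARQ.pProb μ γ proto F R θ m f) ∧
      -- the outage probability
      μ.real {ω | (∀ t < M, HARQ.quantFeedback proto F R θ t (fun i => γ i ω) = 0) ∧
          ¬ HARQ.decoded proto R ((HARQ.proposed proto F R θ).snr (fun i => γ i ω)) M} =
        HARQ.pOut μ γ proto M R θ ∧
      -- mean inter-renewal time, reward and cost
      (HARQ.proposed proto F R θ).meanTime μ γ M = HARQ.timeSum μ γ proto M F R θ ∧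
      (HARQ.proposed proto F R θ).meanReward μ γ proto M = R * (1 - HARQ.pOut μ γ proto M R θ) ∧
      (HARQ.proposed proto F R θ).meanCost μ γ M =
        (Real.exp R - 1) * HARQ.powerSum μ γ proto M F R θ ∧
      -- the average power equals the budget exactly for the rate in the formula
      ((HARQ.proposed proto F R θ).HasAveragePower μ γ M Pbar ↔
        R = HARQ.rateFormula μ γ proto M F Pbar R θ) ∧
      -- and then the throughput is given by the formula, in renewal and in long-term form
      (R = HARQ.rateFormula μ γ proto M F Pbar R θ →
        (HARQ.proposed proto F R θ).meanCost μ γ M / (HARQ.proposed proto F R θ).meanTime μ γ M =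
            Pbar ∧
        (HARQ.proposed proto F R θ).meanReward μ γ proto M /
            (HARQ.proposed proto F R θ).meanTime μ γ M =
          HARQ.throughputFormula μ γ proto M F Pbar R θ ∧
        (HARQ.proposed proto F R θ).HasThroughput μ γ proto M
          (HARQ.throughputFormula μ γ proto M F Pbar R θ))) ∧
    -- closed form of the ALO probabilities
    (∀ (R : ℝ) (θ : HARQ.Thresholds), θ.Valid M F → ∀ m ≤ M, ∀ a : ℝ≥0∞,
      HARQ.ptilde μ γ .ALO R θ m a =
          (∏ t ∈ Finset.range m, μ.real {ω | (γ 0 ω : ℝ≥0∞) < min (θ.τ t) (θ.s t 1)}) *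
            μ.real {ω | (γ 0 ω : ℝ≥0∞) < a} ∧
      ((∀ x : ℝ≥0, μ {ω | γ 0 ω = x} = 0) →
        HARQ.ptilde μ γ .ALO R θ m a =
          (∏ t ∈ Finset.range m, μ.real {ω | (γ 0 ω : ℝ≥0∞) ≤ min (θ.τ t) (θ.s t 1)}) *
            μ.real {ω | (γ 0 ω : ℝ≥0∞) ≤ a})) ∧
    -- for ALO and RTD the formula does not involve the rate: plain maximization over thresholds
    (proto ≠ .INR → ∀ R : ℝ,
      HARQ.etaLB μ γ proto M F Pbar =
        sSup {y | ∃ θ : HARQ.Thresholds, θ.Valid M F ∧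
          y = ENNReal.ofReal (HARQ.throughputFormula μ γ proto M F Pbar R θ)}) ∧
    -- the formula is a lower bound for the optimal throughput
    HARQ.etaLB μ γ proto M F Pbar ≤ HARQ.optRenewalThroughput μ γ proto M F Pbar ∧
    HARQ.etaLB μ γ proto M F Pbar ≤ HARQ.optThroughput μ γ proto M F Pbar := by
  have hav : ∀ (R : ℝ) (θ : HARQ.Thresholds), 0 < R → θ.Valid M F →
      R = HARQ.rateFormula μ γ proto M F Pbar R θ →
      (HARQ.proposed proto F R θ).meanCost μ γ M / (HARQ.proposed proto F R θ).meanTime μ γ M =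
          Pbar ∧
        (HARQ.proposed proto F R θ).meanReward μ γ proto M /
            (HARQ.proposed proto F R θ).meanTime μ γ M =
          HARQ.throughputFormula μ γ proto M F Pbar R θ := by
    intro R θ hR hθ hRf
    rw [HARQ.proposed_meanCost hmeas hR hθ hM hF, HARQ.proposed_meanTime hmeas hR hθ hM hF,
      HARQ.proposed_meanReward hmeas hR hθ hM hF]
    refine ⟨(HARQ.mean_power_eq_iff hP hR (HARQ.powerSum_nonneg hmeas hR hθ hM hF)).2 hRf, ?_⟩
    rw [HARQ.throughputFormula, ← hRf]
    ring
  refine ⟨fun R θ hR hθ => ?_, fun R θ hθ m hm a => ?_, fun hproto R => ?_, ?_, ?_⟩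
  · have hadm := HARQ.proposed_admissible (proto := proto) hR hθ hF
    refine ⟨hadm, fun m hm f hf => HARQ.measureReal_feedback_le hR hθ hF hm hf,
      HARQ.measureReal_outage hR hθ hF, HARQ.proposed_meanTime hmeas hR hθ hM hF,
      HARQ.proposed_meanReward hmeas hR hθ hM hF, HARQ.proposed_meanCost hmeas hR hθ hM hF,
      ?_, fun hRf => ?_⟩
    · have hp := hadm.hasAveragePower hmeas hindep hident hM
      rw [← HARQ.mean_power_eq_iff hP hR (HARQ.powerSum_nonneg hmeas hR hθ hM hF),
        ← HARQ.proposed_meanCost hmeas hR hθ hM hF, ← HARQ.proposed_meanTime hmeas hR hθ hM hF]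
      -- The almost sure average power always exists and equals the ratio of means; uniqueness of
      -- limits gives the converse.
      exact ⟨fun h => hp.unique h, fun h => h ▸ hp⟩
    · obtain ⟨h1, h2⟩ := hav R θ hR hθ hRf
      exact ⟨h1, h2, h2 ▸ hadm.hasThroughput hmeas hindep hident hM⟩
  · have h := HARQ.ptilde_ALO hindep hident hθ R hm a
    refine ⟨h, fun hatom => ?_⟩
    simp only [h, HARQ.measureReal_lt_eq_le hatom]
  · apply le_antisymm
    · refine sSup_le ?_
      rintro y ⟨R', θ, -, hθ, -, rfl⟩
      exact le_sSup ⟨θ, hθ, by rw [HARQ.throughputFormula_rate hproto Pbar R' R]⟩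
    · refine sSup_le ?_
      rintro y ⟨θ, hθ, rfl⟩
      -- The rate `1` is an arbitrary positive choice, as nothing here depends on the rate. If `D =
      -- 0`, the formula has value `0`, and these thresholds cannot raise the supremum.
      have hD := HARQ.powerSum_nonneg (μ := μ) (proto := proto) hmeas one_pos hθ hM hF
      rcases hD.eq_or_lt with h0 | hpos
      · rw [HARQ.throughputFormula_rate hproto Pbar R 1, HARQ.throughputFormula,
          HARQ.rateFormula, ← h0]
        simp
      -- The fixed-point equation for the rate is solved by the formula itself, since its right-hand
      -- side is constant in `R`.
      · refine le_sSup ⟨HARQ.rateFormula μ γ proto M F Pbar 1 θ, θ, HARQ.rateFormula_pos hP hpos,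
          hθ, HARQ.rateFormula_rate hproto Pbar _ _, ?_⟩
        rw [HARQ.throughputFormula_rate hproto Pbar]
  · refine sSup_le ?_
    rintro y ⟨R, θ, hR, hθ, hRf, rfl⟩
    obtain ⟨h1, h2⟩ := hav R θ hR hθ hRf
    exact le_sSup ⟨_, HARQ.proposed_admissible hR hθ hF, h1.le, by rw [h2]⟩
  · refine sSup_le ?_
    rintro y ⟨R, θ, hR, hθ, hRf, rfl⟩
    obtain ⟨h1, h2⟩ := hav R θ hR hθ hRf
    have hadm := HARQ.proposed_admissible (proto := proto) hR hθ hF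
    exact le_sSup ⟨_, _, _, hadm, h2 ▸ hadm.hasThroughput hmeas hindep hident hM,
      hadm.hasAveragePower hmeas hindep hident hM, h1.le, rfl⟩
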